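/- Let $\mathcal S,\mathcal A$ be finite nonempty sets, $C:\mathcal S\times\mathcal A\to[0,1]$ a cost, $P(\cdot\mid s,a)$ transition probabilities on $\mathcal S$, $\gamma\in(0,1)$, $\lambda\in[0,1]$, $\alpha\in(0,1)$, and $\mathcal H=\{0,\tfrac1H,\dots,1\}$ with an integer $H\ge1$ (so $|\mathcal H|=H+1$). A policy is a pair $\pi=(\pi_1,\pi_2)$ of families of probability distributions $\pi_1(a,\eta'\mid s)$ and $\pi_2(a,\eta'\mid s,\eta)$ on $\mathcal A\times\mathcal H$. Put $\bar c(s,\eta,a,\eta')=\frac{\lambda}{\alpha}[C(s,a)-\eta]_++(1-\lambda)C(s,a)+\gamma\lambda\eta'$. On $\mathcal S\times\mathcal H$ consider the Markov chain with transition probabilities $\mathrm{Pr}^{\pi}(s',\eta'\mid s,\eta)=\sum_a\pi_2(a,\eta'\mid s,\eta)P(s'\mid s,a)$. Let $\hat J^{\pi_2}(s,\eta)$ be the expected $\gamma$-discounted sum of the costs $\bar c$ when this chain starts at $(s,\eta)$ and actions $(a,\eta')$ are drawn from $\pi_2$. Let $$Q^{\pi_2}(s,a,\eta')=C(s,a)+\gamma\lambda\eta'+\gamma\sum_{s'}P(s'\mid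 s,a)\hat J^{\pi_2}(s',\eta'),\qquad J^\pi(\rho)=\sum_s\rho(s)\sum_{a,\eta'}\pi_1(a,\eta'\mid s)Q^{\pi_2}(s,a,\eta'),$$ and $J^*(\rho)=\min_\pi J^\pi(\rho)$, attained at an optimal policy $\pi^*$. For $\theta=(\theta_1,\theta_2)$ let $\pi^\theta$ be the softmax policy, $\pi_1^\theta(a,\eta'\mid s)\propto\exp\theta_1(s,a,\eta')$ and $\pi_2^\theta(a,\eta'\mid s,\eta)\propto\exp\theta_2(s,\eta,a,\eta')$. For a distribution $\mu$ on $\mathcal S$ and $\kappa>0$ let $$L_\kappa(\theta)=J^{\pi^\theta}(\mu)+\frac{\kappa}{|\mathcal S|}\sum_s\mathrm{KL}\big(\mathrm{Unif}_{\mathcal A\times\mathcal H},\pi_1^\theta(\cdot\mid s)\big)+\frac{\kappa}{|\mathcal S||\mathcal H|}\sum_{s,\eta}\mathrm{KL}\big(\mathrm{Unif}_{\mathcal A\times\mathcal H},\pi_2^\theta(\cdot\mid s,\eta)\big),$$ where $\mathrm{KL}(p,q)=\sum_xp(x)\log\frac{p(x)}{q(x)}$. Put $\|\bar c\|_\infty=\frac\lambda\alpha+(1-\lambda)+\gamma\lambda$,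 $\bar C=\frac\lambda\alpha+\lambda+\frac{1}{1-\gamma}\|\bar c\|_\infty$ and $\sigma_\kappa=6(\frac\lambda\alpha+\lambda)+\frac{8}{(1-\gamma)^3}\|\bar c\|_\infty+\frac{2\kappa}{|\mathcal S|}+\frac{2\kappa}{|\mathcal S||\mathcal H|}$. From any $\theta^{(0)}$ with finite entries let $\theta^{(t+1)}=\theta^{(t)}-\frac1{\sigma_\kappa}\nabla L_\kappa(\theta^{(t)})$, let $J^{(t)}=J^{\pi^{\theta^{(t)}}}$, and let $$\pi_1^{LB}=\inf_{t\ge1}\min_{s,a,\eta'}\pi_1^{\theta^{(t)}}(a,\eta'\mid s),\qquad \pi_2^{LB}=\inf_{t\ge1}\min_{s,\eta,a,\eta'}\pi_2^{\theta^{(t)}}(a,\eta'\mid s,\eta),\qquad \bar B=\bar C-\log\pi_1^{LB}-\log\pi_2^{LB}.$$ For a distribution $\rho$ on $\mathcal S$ let $\rho^{\pi^*}(s,\eta)=\sum_{s_1,a_1}\rho(s_1)\pi^*_1(a_1,\eta\mid s_1)P(s\mid s_1,a_1)$, let $d^{\pi^*}_{\rho^{\pi^*}}$ be the normalized $\gamma$-discounted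 visitation distribution on $\mathcal S\times\mathcal H$ of the chain $\mathrm{Pr}^{\pi^*}$ started from $\rho^{\pi^*}$, let $\mu^P(s,\eta)=\sum_{s_1,a_1}\mu(s_1)P(s\mid s_1,a_1)$, and let $$D_2=\Big\|\frac{\rho}{\mu}\Big\|_\infty+\frac{1}{(1-\gamma)\pi_1^{LB}}\Big\|\frac{d^{\pi^*}_{\rho^{\pi^*}}}{\mu^P}\Big\|_\infty ,$$ where both ratios are assumed finite (with $\frac00=0$; for instance $\mu>0$ and $\mu^P>0$). **Theorem.** Let $\rho,\mu$ be distributions on $\mathcal S$ and $\pi^*$ an optimal policy for $J^\pi(\rho)$ such that the two ratios are finite, let $\theta^{(0)}$ be arbitrary, and let $\epsilon>0$. Let the iterates be run with $\kappa=\frac{\epsilon}{2D_2}$ (where $D_2$ is that of the run itself), and let $\kappa\le1$. Then $$\min_{1\le t\le T}J^{(t)}(\rho)-J^*(\rho)\le\epsilon\quad\text{whenever}\quad T\ge\frac{64\big(3(\frac\lambda\alpha+\lambda)+4\|\bar c\|_\infty+2\big)\bar B\,|\mathcal S|^2|\mathcal A|^2|\mathcal H|^4}{(1-\gamma)^3\epsilon^2}D_2^2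 .$$ -/

import Mathlib

noncomputable section

/-- The grid `{0, 1/H, …, 1}` of values of the auxiliary variable `η`, indexed by `0, …, H`. -/
abbrev EtaGrid (H : ℕ) : Type := Fin (H + 1)

/-- The real number `h / H` represented by the grid index `h`. -/
def etaVal {H : ℕ} (h : EtaGrid H) : ℝ := (h : ℝ) / (H : ℝ)

/-- A finite discounted MDP with costs in `[0, 1]`, transition probabilities `P(s' | s, a)` and
discount factor `γ ∈ (0, 1)`, together with the weight `lam ∈ [0, 1]` and the confidence level
`α ∈ (0, 1)` of the one-step risk measure `(1 - lam) 𝔼 + lam CVaR_α`. -/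
structure RiskMDP (S A : Type*) [Fintype S] where
  cost : S → A → ℝ
  cost_mem : ∀ s a, cost s a ∈ Set.Icc (0 : ℝ) 1
  P : S → A → S → ℝ
  P_mem : ∀ s a, P s a ∈ stdSimplex ℝ S
  γ : ℝ
  γ_mem : γ ∈ Set.Ioo (0 : ℝ) 1
  lam : ℝ
  lam_mem : lam ∈ Set.Icc (0 : ℝ) 1
  α : ℝ
  α_mem : α ∈ Set.Ioo (0 : ℝ) 1

/-- A pair of policies: `one s (a, η')` is `π₁(a, η' | s)`, used at the first time step, and
`two (s, η) (a, η')` is the stationary policy `π₂(a, η' | s, η)`, used at all later steps. -/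
structure RiskPolicy (S A : Type*) [Fintype A] (H : ℕ) where
  one : S → A × EtaGrid H → ℝ
  two : S × EtaGrid H → A × EtaGrid H → ℝ
  one_mem : ∀ s, one s ∈ stdSimplex ℝ (A × EtaGrid H)
  two_mem : ∀ z, two z ∈ stdSimplex ℝ (A × EtaGrid H)

/-- The softmax function. -/
def softmaxFun {X : Type*} [Fintype X] (v : X → ℝ) (x : X) : ℝ :=
  Real.exp (v x) / ∑ y, Real.exp (v y)

theorem softmaxFun_mem {X : Type*} [Fintype X] [Nonempty X] (v : X → ℝ) :
    softmaxFun v ∈ stdSimplex ℝ X := by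
  have hpos : 0 < ∑ y, Real.exp (v y) :=
    Finset.sum_pos (fun y _ => Real.exp_pos _) Finset.univ_nonempty
  refine ⟨fun x => div_nonneg (Real.exp_pos _).le hpos.le, ?_⟩
  unfold softmaxFun
  rw [← Finset.sum_div, div_self hpos.ne']

/-- The space of parameters `θ = (θ₁, θ₂)` with its Euclidean norm: `Sum.inl (s, a, η')` indexes the
coordinates of `θ₁`, and `Sum.inr ((s, η), a, η')` those of `θ₂`. -/
abbrev RiskParam (S A : Type*) (H : ℕ) : Type _ :=
  EuclideanSpace ℝ ((S × (A × EtaGrid H)) ⊕ ((S × EtaGrid H) × (A × EtaGrid H)))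

/-- The softmax policy `π^θ`. -/
def softmaxPolicy {S A : Type*} [Fintype A] [Nonempty A] {H : ℕ}
    (θ : RiskParam S A H) : RiskPolicy S A H where
  one s := softmaxFun fun x => θ (Sum.inl (s, x))
  two z := softmaxFun fun x => θ (Sum.inr (z, x))
  one_mem _ := softmaxFun_mem _
  two_mem _ := softmaxFun_mem _

/-- The relative entropy `KL(p, q) = 𝔼_{x ∼ p}[-log (q x / p x)]` on a finite set. -/
def finKL {X : Type*} [Fintype X] (p q : X → ℝ) : ℝ :=
  ∑ x, p x * (-Real.log (q x / p x))

/-- The uniform distribution on a finite set. -/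
def unifDist (X : Type*) [Fintype X] : X → ℝ := fun _ => 1 / (Fintype.card X : ℝ)

/-- The norm `‖p / q‖_∞` of the ratio of two distributions on a finite set (with `0 / 0 = 0`; it is
only used where `q x = 0` implies `p x = 0`). -/
def ratioNorm {X : Type*} (p q : X → ℝ) : ℝ := ⨆ x, |p x / q x|

namespace RiskMDP

variable {S A : Type*} [Fintype S] [DecidableEq S] [Fintype A] {H : ℕ}

/-- The modified cost at time steps `t ≥ 2`:
`(lam/α) [C(s,a) - η]₊ + (1 - lam) C(s,a) + γ lam η'`. -/
def laterCost (M : RiskMDP S A) (z : S × EtaGrid H) (x : A × EtaGrid H) : ℝ :=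
  M.lam / M.α * max (M.cost z.1 x.1 - etaVal z.2) 0 + (1 - M.lam) * M.cost z.1 x.1
    + M.γ * M.lam * etaVal x.2

/-- The one-step transition matrix of the augmented state `(s_t, η_t)`, `t ≥ 2`:
`Pr^π(s_{t+1} = s', η_{t+1} = η' | s_t = s, η_t = η) = ∑ₐ π₂(a, η' | s, η) P(s' | s, a)`. -/
def transMatrix (M : RiskMDP S A) (π : RiskPolicy S A H) :
    Matrix (S × EtaGrid H) (S × EtaGrid H) ℝ :=
  Matrix.of fun z z' => ∑ a, π.two z (a, z'.2) * M.P z.1 a z'.1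

/-- The expected modified cost in the augmented state `z = (s, η)` under `π₂`. -/
def stepCost (M : RiskMDP S A) (π : RiskPolicy S A H) (z : S × EtaGrid H) : ℝ :=
  ∑ x, π.two z x * M.laterCost z x

/-- The value function `Ĵ^{π₂}(s, η)` for time steps `t ≥ 2`: the expected discounted sum of the
modified costs from the augmented state `(s, η)` on. -/
def laterValue (M : RiskMDP S A) (π : RiskPolicy S A H) (z : S × EtaGrid H) : ℝ :=
  ∑' n : ℕ, M.γ ^ n * ((M.transMatrix π) ^ n).mulVec (M.stepCost π) z

/-- The action-value function of the first time step,
`Q^{π₂}(s, a, η') = C(s, a) + γ lam η' + γ 𝔼_{s'}[Ĵ^{π₂}(s', η')]`. -/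
def firstQ (M : RiskMDP S A) (π : RiskPolicy S A H) (s : S) (x : A × EtaGrid H) : ℝ :=
  M.cost s x.1 + M.γ * M.lam * etaVal x.2
    + M.γ * ∑ s', M.P s x.1 s' * M.laterValue π (s', x.2)

/-- The objective `J^π(ρ) = 𝔼_{s ∼ ρ} 𝔼_{(a, η') ∼ π₁(· | s)}[Q^{π₂}(s, a, η')]`. -/
def J (M : RiskMDP S A) (π : RiskPolicy S A H) (ρ : S → ℝ) : ℝ :=
  ∑ s, ρ s * ∑ x, π.one s x * M.firstQ π s x

/-- The optimal objective value `J^*(ρ)`. -/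
def Jstar (M : RiskMDP S A) (H : ℕ) (ρ : S → ℝ) : ℝ :=
  ⨅ π : RiskPolicy S A H, M.J π ρ

/-- `π` is an optimal policy for the starting distribution `ρ`. -/
def IsOptimal (M : RiskMDP S A) (π : RiskPolicy S A H) (ρ : S → ℝ) : Prop :=
  ∀ π' : RiskPolicy S A H, M.J π ρ ≤ M.J π' ρ

/-- The distribution `ρ^π` of `(s₂, η₂)`:
`ρ^π(s, η) = ∑_{s₁} ρ(s₁) ∑_{a₁} π₁(a₁, η | s₁) P(s | s₁, a₁)`. -/
def secondDist (M : RiskMDP S A) (π : RiskPolicy S A H) (ρ : S → ℝ) (z : S × EtaGrid H) : ℝ :=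
  ∑ s₁, ρ s₁ * ∑ a₁, π.one s₁ (a₁, z.2) * M.P s₁ a₁ z.1

/-- The discounted visitation distribution `d_{z₂}^π(z)` of the augmented states from `z₂` on. -/
def visitFrom (M : RiskMDP S A) (π : RiskPolicy S A H) (z₂ z : S × EtaGrid H) : ℝ :=
  (1 - M.γ) * ∑' t : ℕ, M.γ ^ t * ((M.transMatrix π) ^ t) z₂ z

/-- The discounted visitation distribution `d_{ρ^π}^π`. -/
def visit (M : RiskMDP S A) (π : RiskPolicy S A H) (ρ : S → ℝ) (z : S × EtaGrid H) : ℝ :=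
  ∑ z₂, M.secondDist π ρ z₂ * M.visitFrom π z₂ z

/-- `μ^P(s, η) = ∑_{s₁, a₁} μ(s₁) P(s | s₁, a₁)`, for every `η`. -/
def muP (M : RiskMDP S A) (μ : S → ℝ) (z : S × EtaGrid H) : ℝ :=
  ∑ s₁, ∑ a₁, μ s₁ * M.P s₁ a₁ z.1

/-- `‖c̄‖_∞ = lam/α + (1 - lam) + γ lam`. -/
def cbarNorm (M : RiskMDP S A) : ℝ := M.lam / M.α + (1 - M.lam) + M.γ * M.lam

/-- `C̄ = lam/α + lam + ‖c̄‖_∞ / (1 - γ)`. -/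
def Cbar (M : RiskMDP S A) : ℝ := M.lam / M.α + M.lam + 1 / (1 - M.γ) * M.cbarNorm

/-- The smoothness constant `σ_κ`. -/
def sigma (M : RiskMDP S A) (H : ℕ) (κ : ℝ) : ℝ :=
  6 * (M.lam / M.α + M.lam) + 8 / (1 - M.γ) ^ 3 * M.cbarNorm
    + 2 * κ / (Fintype.card S : ℝ)
    + 2 * κ / ((Fintype.card S : ℝ) * (Fintype.card (EtaGrid H) : ℝ))

variable [Nonempty A]

/-- The log-barrier regularized objective `L_κ(θ)`: `J^{π^θ}(μ)` plus `κ` times the averages, over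
all `s` and over all `(s, η)`, of the relative entropies of `π₁^θ` and `π₂^θ` with respect to the
uniform distribution. -/
def L (M : RiskMDP S A) (μ : S → ℝ) (κ : ℝ) (θ : RiskParam S A H) : ℝ :=
  M.J (softmaxPolicy θ) μ
    + κ * ∑ s, unifDist S s * finKL (unifDist (A × EtaGrid H)) ((softmaxPolicy θ).one s)
    + κ * ∑ z, unifDist (S × EtaGrid H) z *
        finKL (unifDist (A × EtaGrid H)) ((softmaxPolicy θ).two z)

/-- The gradient descent iterates `θ^{(t+1)} = θ^{(t)} - (1/σ_κ) ∇L_κ(θ^{(t)})` from `θ^{(0)}`. -/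
def iter (M : RiskMDP S A) (μ : S → ℝ) (κ : ℝ) (θ₀ : RiskParam S A H) : ℕ → RiskParam S A H
  | 0 => θ₀
  | t + 1 => iter M μ κ θ₀ t
      - (1 / M.sigma H κ) • gradient (M.L μ κ) (iter M μ κ θ₀ t)

/-- The policy `π^{θ^{(t)}}`. -/
def iterPolicy (M : RiskMDP S A) (μ : S → ℝ) (κ : ℝ) (θ₀ : RiskParam S A H) (t : ℕ) :
    RiskPolicy S A H :=
  softmaxPolicy (M.iter μ κ θ₀ t)

/-- `π₁^{LB} = inf_{t ≥ 1} min_{s, a, η} π₁^{θ^{(t)}}(a, η | s)`. -/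
def piLB₁ (M : RiskMDP S A) (μ : S → ℝ) (κ : ℝ) (θ₀ : RiskParam S A H) : ℝ :=
  ⨅ t : ℕ, ⨅ s : S, ⨅ x : A × EtaGrid H, (M.iterPolicy μ κ θ₀ (t + 1)).one s x

/-- `π₂^{LB} = inf_{t ≥ 1} min_{s, a, η, η'} π₂^{θ^{(t)}}(a, η' | s, η)`. -/
def piLB₂ (M : RiskMDP S A) (μ : S → ℝ) (κ : ℝ) (θ₀ : RiskParam S A H) : ℝ :=
  ⨅ t : ℕ, ⨅ z : S × EtaGrid H, ⨅ x : A × EtaGrid H, (M.iterPolicy μ κ θ₀ (t + 1)).two z x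

/-- `D₂ = ‖ρ/μ‖_∞ + ‖d_{ρ^{π^*}}^{π^*} / μ^P‖_∞ / ((1 - γ) π₁^{LB})`. -/
def D₂ (M : RiskMDP S A) (μ ρ : S → ℝ) (πs : RiskPolicy S A H) (κ : ℝ)
    (θ₀ : RiskParam S A H) : ℝ :=
  ratioNorm ρ μ
    + 1 / ((1 - M.γ) * M.piLB₁ μ κ θ₀) * ratioNorm (M.visit πs ρ) (M.muP μ)

/-- `B̄ = C̄ - log π₁^{LB} - log π₂^{LB}`. -/
def Bbar (M : RiskMDP S A) (μ : S → ℝ) (κ : ℝ) (θ₀ : RiskParam S A H) : ℝ :=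
  M.Cbar - Real.log (M.piLB₁ μ κ θ₀) - Real.log (M.piLB₂ μ κ θ₀)

end RiskMDP

end

/-! Both stages are read as one discounted control problem on the disjoint union `S ⊕ (S × EtaGrid
H)`, whose first-stage states are never re-entered. Then `J` is a value function averaged over
initial weights carried by `S` (`J_eq`), and `L` is such a value plus weighted KL barriers of a
single tabular softmax policy (`L_eq_barrierObjective`).

Smoothness: the value difference of two policies solves a Bellman equation, and so does its
first-order remainder. Applying the maximum principle twice, with elementary bounds for softmax
means, gives a global quadratic remainder bound (`abs_policyValue_sub_sub_le`,
`abs_barrierObjective_sub_sub_le`). This one bound identifies the gradient and yields descent with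
step `1 / σ`.

Optimization: each step lowers `L` by at least `‖∇L‖² / (2σ)`. Since `0 ≤ L` and `L` is at most
`Bbar` at iterate 1, some iterate among `1, …, T` has a small gradient. The barrier also bounds all
action probabilities below along the run.

Gradient domination: where the gradient is small compared with the barrier, no action has a
visit-weighted advantage below `-κ w` (`neg_le_visits_mul_advantage`). The performance difference
identity (`sum_mul_policyValue_sub`) expresses suboptimality by advantages weighted with visits of
the optimal policy. Exchanging these for visits of the current policy, which dominate `μ` in stage
one and `γ π₁^LB μ^P` in stage two, costs the factor `D₂` (`J_sub_J_le`). The error is therefore at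
most `κ D₂ = ε / 2`. -/

/-! ### Discounted Markov chains: maximum principle and resolvent. -/

section DiscountedResolvent

open Matrix

variable {Z : Type*} [Fintype Z] [DecidableEq Z] {P : Matrix Z Z ℝ} {γ : ℝ}

theorem mulVec_le_of_mem_rowStochastic (hP : P ∈ rowStochastic ℝ Z) {v : Z → ℝ} {K : ℝ}
    (h : ∀ z, v z ≤ K) (z : Z) : (P *ᵥ v) z ≤ K := by
  calc (P *ᵥ v) z = ∑ y, P z y * v y := rfl
    _ ≤ ∑ y, P z y * K := by
      gcongr with y
      · exact nonneg_of_mem_rowStochastic hP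
      · exact h y
    _ = K := by rw [← Finset.sum_mul, sum_row_of_mem_rowStochastic hP, one_mul]

/-- The maximum principle for the discounted chain. -/
theorem le_div_of_le_add_discounted (hP : P ∈ rowStochastic ℝ Z) (h0 : 0 ≤ γ) (h1 : γ < 1)
    {W : Z → ℝ} {R : ℝ} (h : ∀ z, W z ≤ R + γ * (P *ᵥ W) z) (z : Z) : W z ≤ R / (1 - γ) := by
  have : Nonempty Z := ⟨z⟩
  -- At a maximizer `y` the averaged value is at most `W y`, so `(1 - γ) W y ≤ R`.
  obtain ⟨y, hy⟩ := Finite.exists_max W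
  have h2 := h y
  have h3 := mul_le_mul_of_nonneg_left (mulVec_le_of_mem_rowStochastic hP hy y) h0
  refine (hy z).trans ?_
  rw [le_div_iff₀ (by linarith)]
  linarith

theorem abs_le_div_of_eq_add_discounted (hP : P ∈ rowStochastic ℝ Z) (h0 : 0 ≤ γ) (h1 : γ < 1)
    {W r : Z → ℝ} {R : ℝ} (h : ∀ z, W z = r z + γ * (P *ᵥ W) z) (hr : ∀ z, |r z| ≤ R) (z : Z) :
    |W z| ≤ R / (1 - γ) := by
  rw [abs_le']
  constructor
  · refine le_div_of_le_add_discounted hP h0 h1 (fun z => ?_) z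
    linarith [h z, (abs_le.1 (hr z)).2]
  · refine le_div_of_le_add_discounted (W := -W) hP h0 h1 (fun z => ?_) z
    rw [mulVec_neg, Pi.neg_apply, Pi.neg_apply]
    linarith [h z, (abs_le.1 (hr z)).1]

theorem nonneg_of_eq_add_discounted (hP : P ∈ rowStochastic ℝ Z) (h0 : 0 ≤ γ) (h1 : γ < 1)
    {W r : Z → ℝ} (h : ∀ z, W z = r z + γ * (P *ᵥ W) z) (hr : ∀ z, 0 ≤ r z) (z : Z) :
    0 ≤ W z := by
  have := le_div_of_le_add_discounted (W := -W) (R := 0) hP h0 h1 (fun z => by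
    rw [mulVec_neg, Pi.neg_apply, Pi.neg_apply]
    linarith [h z, hr z]) z
  rw [zero_div, Pi.neg_apply] at this
  linarith

/-- Two vectors with the same image differ by a solution of the homogeneous equation, which vanishes
by the maximum principle. -/
theorem isUnit_one_sub_smul (hP : P ∈ rowStochastic ℝ Z) (h0 : 0 ≤ γ) (h1 : γ < 1) :
    IsUnit (1 - γ • P) := by
  rw [← mulVec_injective_iff_isUnit]
  intro v w hvw
  have hd : ∀ z, (v - w) z = (0 : Z → ℝ) z + γ * (P *ᵥ (v - w)) z := fun z => by
    have := congrFun hvw z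
    simp only [sub_mulVec, one_mulVec, smul_mulVec, Pi.sub_apply, Pi.smul_apply,
      smul_eq_mul] at this
    simp only [mulVec_sub, Pi.sub_apply, Pi.zero_apply]
    linarith
  funext z
  have := abs_le_div_of_eq_add_discounted hP h0 h1 hd (R := 0) (by simp) z
  rw [zero_div] at this
  exact sub_eq_zero.1 (abs_nonpos_iff.1 this)

/-- The resolvent `∑ₙ γⁿ Pⁿ = (1 - γ P)⁻¹` of a discounted chain. -/
noncomputable def discountedResolvent (γ : ℝ) (P : Matrix Z Z ℝ) : Matrix Z Z ℝ := (1 - γ • P)⁻¹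

theorem discountedResolvent_eq_left (hP : P ∈ rowStochastic ℝ Z) (h0 : 0 ≤ γ) (h1 : γ < 1) :
    discountedResolvent γ P = 1 + γ • (P * discountedResolvent γ P) := by
  have h := mul_nonsing_inv _ ((isUnit_iff_isUnit_det _).1 (isUnit_one_sub_smul hP h0 h1))
  rw [sub_mul, one_mul, smul_mul_assoc] at h
  exact sub_eq_iff_eq_add.1 h

theorem discountedResolvent_eq_right (hP : P ∈ rowStochastic ℝ Z) (h0 : 0 ≤ γ) (h1 : γ < 1) :
    discountedResolvent γ P = 1 + γ • (discountedResolvent γ P * P) := by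
  have h := nonsing_inv_mul _ ((isUnit_iff_isUnit_det _).1 (isUnit_one_sub_smul hP h0 h1))
  rw [mul_sub, mul_one, mul_smul_comm] at h
  exact sub_eq_iff_eq_add.1 h

theorem discountedResolvent_mulVec (hP : P ∈ rowStochastic ℝ Z) (h0 : 0 ≤ γ) (h1 : γ < 1)
    (r : Z → ℝ) (z : Z) :
    (discountedResolvent γ P *ᵥ r) z = r z + γ * (P *ᵥ (discountedResolvent γ P *ᵥ r)) z := by
  conv_lhs => rw [discountedResolvent_eq_left hP h0 h1]
  simp [add_mulVec, smul_mulVec]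

theorem eq_discountedResolvent_mulVec (hP : P ∈ rowStochastic ℝ Z) (h0 : 0 ≤ γ) (h1 : γ < 1)
    {W r : Z → ℝ} (h : ∀ z, W z = r z + γ * (P *ᵥ W) z) : W = discountedResolvent γ P *ᵥ r := by
  apply mulVec_injective_iff_isUnit.2 (isUnit_one_sub_smul hP h0 h1)
  funext z
  have := discountedResolvent_mulVec hP h0 h1 r z
  have := h z
  simp only [sub_mulVec, one_mulVec, smul_mulVec, Pi.sub_apply, Pi.smul_apply, smul_eq_mul]
  linarith

/-- The row-vector counterpart, used to identify visitation measures by their balance equation. -/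
theorem eq_vecMul_discountedResolvent (hP : P ∈ rowStochastic ℝ Z) (h0 : 0 ≤ γ) (h1 : γ < 1)
    {d m : Z → ℝ} (h : ∀ z, d z = m z + γ * (d ᵥ* P) z) : d = m ᵥ* discountedResolvent γ P := by
  have hm : m = d ᵥ* (1 - γ • P) := by
    funext z
    have := h z
    simp only [vecMul_sub, vecMul_one, vecMul_smul, Pi.sub_apply, Pi.smul_apply, smul_eq_mul]
    linarith
  rw [hm, discountedResolvent, vecMul_vecMul,
    mul_nonsing_inv _ ((isUnit_iff_isUnit_det _).1 (isUnit_one_sub_smul hP h0 h1)), vecMul_one]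

/-- A column of the resolvent is the value function of an indicator cost, hence nonnegative. -/
theorem discountedResolvent_nonneg (hP : P ∈ rowStochastic ℝ Z) (h0 : 0 ≤ γ) (h1 : γ < 1)
    (z y : Z) : 0 ≤ discountedResolvent γ P z y := by
  have := nonneg_of_eq_add_discounted hP h0 h1
    (discountedResolvent_mulVec hP h0 h1 (Pi.single y 1))
    (fun x => (Pi.single_nonneg.2 zero_le_one : (0 : Z → ℝ) ≤ Pi.single y 1) x) z
  simpa [mulVec_single_one] using this

/-- The unnormalized visitation measure dominates the first two steps of the chain. -/
theorem add_vecMul_le_vecMul_discountedResolvent (hP : P ∈ rowStochastic ℝ Z) (h0 : 0 ≤ γ)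
    (h1 : γ < 1) {m : Z → ℝ} (hm : ∀ z, 0 ≤ m z) (z : Z) :
    m z + γ * (m ᵥ* P) z ≤ (m ᵥ* discountedResolvent γ P) z := by
  have hN := discountedResolvent_eq_right hP h0 h1
  have hle : ∀ y, m y ≤ (m ᵥ* discountedResolvent γ P) y := fun y => by
    rw [hN, vecMul_add, vecMul_one, vecMul_smul, Pi.add_apply, Pi.smul_apply, smul_eq_mul,
      ← vecMul_vecMul]
    have := nonneg_vecMul_of_mem_rowStochastic hP (x := m ᵥ* discountedResolvent γ P) (fun i =>
      Finset.sum_nonneg fun j _ => mul_nonneg (hm j) (discountedResolvent_nonneg hP h0 h1 j i)) y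
    nlinarith [mul_nonneg h0 this]
  conv_rhs => rw [hN, vecMul_add, vecMul_one, vecMul_smul, Pi.add_apply, Pi.smul_apply,
    smul_eq_mul, ← vecMul_vecMul]
  gcongr
  exact Finset.sum_le_sum fun y _ =>
    mul_le_mul_of_nonneg_right (hle y) (nonneg_of_mem_rowStochastic hP)

/-- Splitting off the term `n = 0` shows that the series solves the fixed-point equation, whose
solution is unique. -/
theorem tsum_discounted_eq (hP : P ∈ rowStochastic ℝ Z) (h0 : 0 ≤ γ) (h1 : γ < 1)
    (r : Z → ℝ) (z : Z) :
    ∑' n : ℕ, γ ^ n * ((P ^ n) *ᵥ r) z = (discountedResolvent γ P *ᵥ r) z := by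
  obtain ⟨K, hK⟩ : ∃ K, ∀ y, |r y| ≤ K :=
    ⟨∑ y, |r y|, fun y => Finset.single_le_sum (fun y _ => abs_nonneg (r y)) (Finset.mem_univ y)⟩
  have hs : ∀ y, Summable fun n : ℕ => γ ^ n * ((P ^ n) *ᵥ r) y := fun y => by
    refine Summable.of_norm_bounded ((summable_geometric_of_lt_one h0 h1).mul_right K)
      fun n => ?_
    rw [norm_mul, Real.norm_of_nonneg (pow_nonneg h0 n), Real.norm_eq_abs]
    refine mul_le_mul_of_nonneg_left ?_ (pow_nonneg h0 n)
    have hPn := pow_mem hP n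
    rw [abs_le']
    refine ⟨mulVec_le_of_mem_rowStochastic hPn (fun y => (abs_le.1 (hK y)).2) y, ?_⟩
    have := mulVec_le_of_mem_rowStochastic hPn (v := -r) (K := K)
      (fun y => by rw [Pi.neg_apply]; linarith [(abs_le.1 (hK y)).1]) y
    rwa [mulVec_neg] at this
  refine congrFun (eq_discountedResolvent_mulVec
    (W := fun z => ∑' n : ℕ, γ ^ n * ((P ^ n) *ᵥ r) z) hP h0 h1 fun y => ?_) z
  rw [(hs y).tsum_eq_zero_add]
  congr 1
  · simp
  · have : (P *ᵥ fun z => ∑' n : ℕ, γ ^ n * ((P ^ n) *ᵥ r) z) y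
        = ∑' n : ℕ, γ ^ n * ((P ^ (n + 1)) *ᵥ r) y := by
      change ∑ x, P y x * ∑' n : ℕ, γ ^ n * ((P ^ n) *ᵥ r) x = _
      simp_rw [← tsum_mul_left]
      rw [← Summable.tsum_finsetSum fun x _ => (hs x).mul_left _]
      refine tsum_congr fun n => ?_
      rw [pow_succ', ← mulVec_mulVec]
      simp only [mulVec, dotProduct, Finset.mul_sum]
      refine Finset.sum_congr rfl fun x _ => Finset.sum_congr rfl fun w _ => ?_
      ring
    rw [this, ← tsum_mul_left]
    refine tsum_congr fun n => ?_
    rw [pow_succ]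
    ring

end DiscountedResolvent

/-! ### First- and second-order estimates for softmax means. -/

section SoftmaxEstimates

variable {X : Type*} [Fintype X]

/-- The mean of `q` under the softmax distribution of `v`. -/
noncomputable def softmaxMean (v q : X → ℝ) : ℝ := ∑ x, softmaxFun v x * q x

theorem softmaxMean_add (v f g : X → ℝ) :
    softmaxMean v (fun x => f x + g x) = softmaxMean v f + softmaxMean v g := by
  simp only [softmaxMean, mul_add, Finset.sum_add_distrib]

theorem softmaxMean_sub (v f g : X → ℝ) :
    softmaxMean v (fun x => f x - g x) = softmaxMean v f - softmaxMean v g := by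
  simp only [softmaxMean, mul_sub, Finset.sum_sub_distrib]

theorem softmaxMean_mul_const (v f : X → ℝ) (a : ℝ) :
    softmaxMean v (fun x => f x * a) = softmaxMean v f * a := by
  simp only [softmaxMean, ← mul_assoc, Finset.sum_mul]

theorem softmaxMean_const_mul (v f : X → ℝ) (a : ℝ) :
    softmaxMean v (fun x => a * f x) = a * softmaxMean v f := by
  simp only [softmaxMean, Finset.mul_sum]
  exact Finset.sum_congr rfl fun x _ => by ring

/-- The covariance of `q` and `δ` under the softmax distribution of `v`. -/
noncomputable def softmaxCov (v q δ : X → ℝ) : ℝ :=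
  softmaxMean v fun x => q x * (δ x - softmaxMean v δ)

theorem softmaxCov_eq (v q δ : X → ℝ) :
    softmaxCov v q δ = softmaxMean v (fun x => q x * δ x) - softmaxMean v q * softmaxMean v δ := by
  rw [softmaxCov, ← softmaxMean_mul_const, ← softmaxMean_sub]
  simp only [mul_sub]

variable [Nonempty X]

theorem sum_exp_pos (v : X → ℝ) : 0 < ∑ y, Real.exp (v y) :=
  Finset.sum_pos (fun _ _ => Real.exp_pos _) Finset.univ_nonempty

theorem softmaxFun_pos (v : X → ℝ) (x : X) : 0 < softmaxFun v x :=
  div_pos (Real.exp_pos _) (sum_exp_pos v)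

theorem softmaxMean_mono (v : X → ℝ) {f g : X → ℝ} (h : ∀ x, f x ≤ g x) :
    softmaxMean v f ≤ softmaxMean v g :=
  Finset.sum_le_sum fun x _ => mul_le_mul_of_nonneg_left (h x) (softmaxFun_pos v x).le

theorem softmaxMean_const (v : X → ℝ) (a : ℝ) : softmaxMean v (fun _ => a) = a := by
  rw [softmaxMean, ← Finset.sum_mul, (softmaxFun_mem v).2, one_mul]

theorem abs_softmaxMean_mul_le (v : X → ℝ) {q f g : X → ℝ} {K : ℝ} (hq : ∀ x, |q x| ≤ K)
    (hf : ∀ x, |f x| ≤ g x) : |softmaxMean v fun x => q x * f x| ≤ K * softmaxMean v g := by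
  have h : ∀ x, |q x * f x| ≤ K * g x := fun x => by
    rw [abs_mul]
    exact mul_le_mul (hq x) (hf x) (abs_nonneg _) ((abs_nonneg _).trans (hq x))
  rw [← softmaxMean_const_mul, abs_le]
  constructor
  · have := softmaxMean_mono v fun x => (abs_le.1 (h x)).1
    simpa [softmaxMean] using this
  · exact softmaxMean_mono v fun x => (abs_le.1 (h x)).2

theorem softmaxMean_sq_sub (v δ : X → ℝ) (a : ℝ) :
    softmaxMean v (fun x => (δ x - a) ^ 2)
      = softmaxMean v (fun x => δ x ^ 2) - 2 * a * softmaxMean v δ + a ^ 2 := by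
  have h : (fun x => (δ x - a) ^ 2) = fun x => (δ x ^ 2 - 2 * a * δ x) + a ^ 2 := by
    funext x; ring
  rw [h, softmaxMean_add, softmaxMean_sub, softmaxMean_const, softmaxMean_const_mul]

theorem softmaxMean_var_le (v δ : X → ℝ) {b : ℝ} (hb : ∑ x, δ x ^ 2 ≤ b ^ 2) :
    softmaxMean v (fun x => (δ x - softmaxMean v δ) ^ 2) ≤ b ^ 2 := by
  have h1 : softmaxMean v (fun x => δ x ^ 2) ≤ b ^ 2 := by
    rw [← softmaxMean_const v (b ^ 2)]
    exact softmaxMean_mono v fun x =>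
      (Finset.single_le_sum (f := fun x => δ x ^ 2) (fun y _ => sq_nonneg _)
        (Finset.mem_univ x)).trans hb
  rw [softmaxMean_sq_sub]
  nlinarith [sq_nonneg (softmaxMean v δ)]

/-- The squared mean of the absolute deviation is at most the variance, because the absolute
deviation itself has nonnegative variance. -/
theorem softmaxMean_abs_dev_le (v δ : X → ℝ) {b : ℝ} (hb0 : 0 ≤ b) (hb : ∑ x, δ x ^ 2 ≤ b ^ 2) :
    softmaxMean v (fun x => |δ x - softmaxMean v δ|) ≤ b := by
  set f : X → ℝ := fun x => |δ x - softmaxMean v δ| with hf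
  have h1 : softmaxMean v (fun x => f x ^ 2) ≤ b ^ 2 := by
    simpa only [hf, sq_abs] using softmaxMean_var_le v δ hb
  have h2 := softmaxMean_sq_sub v f (softmaxMean v f)
  have h3 : 0 ≤ softmaxMean v (fun x => (f x - softmaxMean v f) ^ 2) :=
    Finset.sum_nonneg fun x _ => mul_nonneg (softmaxFun_pos v x).le (sq_nonneg _)
  exact abs_le_of_sq_le_sq' (by nlinarith) hb0 |>.2

theorem abs_softmaxCov_le (v : X → ℝ) {q δ : X → ℝ} {K b : ℝ} (hq : ∀ x, |q x| ≤ K) (hK : 0 ≤ K)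
    (hb0 : 0 ≤ b) (hb : ∑ x, δ x ^ 2 ≤ b ^ 2) : |softmaxCov v q δ| ≤ K * b :=
  (abs_softmaxMean_mul_le v hq fun _ => le_rfl).trans
    (mul_le_mul_of_nonneg_left (softmaxMean_abs_dev_le v δ hb0 hb) hK)

theorem hasDerivAt_log_sum_exp (v δ : X → ℝ) (τ : ℝ) :
    HasDerivAt (fun τ : ℝ => Real.log (∑ x, Real.exp (v x + τ * δ x)))
      (softmaxMean (fun x => v x + τ * δ x) δ) τ := by
  have h : HasDerivAt (fun τ : ℝ => ∑ x, Real.exp (v x + τ * δ x))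
      (∑ x, Real.exp (v x + τ * δ x) * δ x) τ := by
    refine HasDerivAt.fun_sum fun x _ => ?_
    have := (((hasDerivAt_id τ).mul_const (δ x)).const_add (v x)).exp
    simpa using this
  convert h.log (sum_exp_pos _).ne' using 1
  rw [softmaxMean, Finset.sum_div]
  exact Finset.sum_congr rfl fun x _ => by rw [softmaxFun]; ring

theorem softmaxFun_eq_exp (v : X → ℝ) (x : X) :
    softmaxFun v x = Real.exp (v x - Real.log (∑ y, Real.exp (v y))) := by
  rw [Real.exp_sub, Real.exp_log (sum_exp_pos v), softmaxFun]

/-- With the normalization moved into the exponent, this is the chain rule applied to the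
log-partition function. -/
theorem hasDerivAt_softmaxFun (v δ : X → ℝ) (x : X) (τ : ℝ) :
    HasDerivAt (fun τ : ℝ => softmaxFun (fun x => v x + τ * δ x) x)
      (softmaxFun (fun x => v x + τ * δ x) x
        * (δ x - softmaxMean (fun x => v x + τ * δ x) δ)) τ := by
  simp only [softmaxFun_eq_exp]
  have h1 : HasDerivAt (fun τ : ℝ => v x + τ * δ x) (δ x) τ := by
    simpa using ((hasDerivAt_id τ).mul_const (δ x)).const_add (v x)
  exact (h1.sub (hasDerivAt_log_sum_exp v δ τ)).exp

theorem hasDerivAt_softmaxMean (v q δ : X → ℝ) (τ : ℝ) :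
    HasDerivAt (fun τ : ℝ => softmaxMean (fun x => v x + τ * δ x) q)
      (softmaxCov (fun x => v x + τ * δ x) q δ) τ := by
  unfold softmaxCov
  rw [softmaxMean]
  refine HasDerivAt.fun_sum fun x _ => ?_
  exact ((hasDerivAt_softmaxFun v δ x τ).mul_const (q x)).congr_deriv (by ring)

theorem hasDerivAt_softmaxCov (v q δ : X → ℝ) (τ : ℝ) :
    HasDerivAt (fun τ : ℝ => softmaxCov (fun x => v x + τ * δ x) q δ)
      (softmaxMean (fun x => v x + τ * δ x)
          (fun x => q x * (δ x - softmaxMean (fun x => v x + τ * δ x) δ) ^ 2)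
        - softmaxMean (fun x => v x + τ * δ x) q
          * softmaxMean (fun x => v x + τ * δ x)
            (fun x => (δ x - softmaxMean (fun x => v x + τ * δ x) δ) ^ 2)) τ := by
  simp only [softmaxCov_eq]
  refine ((hasDerivAt_softmaxMean v (fun x => q x * δ x) δ τ).sub
    ((hasDerivAt_softmaxMean v q δ τ).mul (hasDerivAt_softmaxMean v δ δ τ))).congr_deriv ?_
  simp only [softmaxCov_eq]
  set w := fun x => v x + τ * δ x
  set m := softmaxMean w δ with hm
  have h : (fun x => q x * (δ x - m) ^ 2)
      = fun x => (q x * δ x * δ x - q x * δ x * (2 * m)) + q x * m ^ 2 := by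
    funext x; ring
  rw [h, softmaxMean_add, softmaxMean_sub, softmaxMean_mul_const, softmaxMean_mul_const,
    softmaxMean_sq_sub, ← hm]
  have h2 : (fun x => δ x ^ 2) = fun x => δ x * δ x := by funext x; ring
  rw [h2]
  ring

theorem abs_sub_le_of_abs_deriv_le {g g' : ℝ → ℝ} {M : ℝ} (hg : ∀ τ, HasDerivAt g (g' τ) τ)
    (hM : ∀ τ, |g' τ| ≤ M) : |g 1 - g 0| ≤ M :=
  norm_image_sub_le_of_norm_deriv_le_segment_01' (fun τ _ => (hg τ).hasDerivWithinAt)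
    fun τ _ => hM τ

/-- The mean value inequality is used twice, first for `g'` and then for `g` minus its linear part.
This gives `M` in place of the sharp `M / 2`, which suffices. -/
theorem abs_taylor_one_le {g g' g'' : ℝ → ℝ} {M : ℝ} (hg : ∀ τ, HasDerivAt g (g' τ) τ)
    (hg' : ∀ τ, HasDerivAt g' (g'' τ) τ) (hM : ∀ τ, |g'' τ| ≤ M) :
    |g 1 - g 0 - g' 0| ≤ M := by
  have hM0 : 0 ≤ M := (abs_nonneg _).trans (hM 0)
  have h1 : ∀ τ ∈ Set.Icc (0 : ℝ) 1, |g' τ - g' 0| ≤ M := fun τ hτ => by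
    have := norm_image_sub_le_of_norm_deriv_le_segment' (a := 0) (b := 1)
      (fun τ _ => (hg' τ).hasDerivWithinAt) (fun τ _ => hM τ) τ hτ
    rw [Real.norm_eq_abs] at this
    nlinarith [hτ.2]
  have h2 := norm_image_sub_le_of_norm_deriv_le_segment_01' (f := fun τ => g τ - τ * g' 0)
    (f' := fun τ => g' τ - g' 0) (C := M)
    (fun τ _ => ((hg τ).sub (by simpa using (hasDerivAt_id τ).mul_const (g' 0))).hasDerivWithinAt)
    (fun τ hτ => h1 τ ⟨hτ.1, hτ.2.le⟩)
  rw [Real.norm_eq_abs] at h2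
  convert h2 using 2
  ring

theorem abs_softmaxMean_sub_le {v w δ q : X → ℝ} (hw : ∀ x, w x = v x + δ x) {K b : ℝ}
    (hq : ∀ x, |q x| ≤ K) (hK : 0 ≤ K) (hb0 : 0 ≤ b) (hb : ∑ x, δ x ^ 2 ≤ b ^ 2) :
    |softmaxMean w q - softmaxMean v q| ≤ K * b := by
  have := abs_sub_le_of_abs_deriv_le (hasDerivAt_softmaxMean v q δ)
    fun τ => abs_softmaxCov_le _ hq hK hb0 hb
  simpa [← hw] using this

/-- The second derivative along the segment has two terms, each at most `K` times a variance, and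
the variance is at most `b ^ 2`. -/
theorem abs_softmaxMean_sub_sub_le {v w δ q : X → ℝ} (hw : ∀ x, w x = v x + δ x) {K b : ℝ}
    (hq : ∀ x, |q x| ≤ K) (hK : 0 ≤ K) (hb : ∑ x, δ x ^ 2 ≤ b ^ 2) :
    |softmaxMean w q - softmaxMean v q - softmaxCov v q δ| ≤ 2 * K * b ^ 2 := by
  have := abs_taylor_one_le (M := 2 * K * b ^ 2) (hasDerivAt_softmaxMean v q δ)
    (hasDerivAt_softmaxCov v q δ) fun τ => by
      set u := fun x => v x + τ * δ x
      have hv := softmaxMean_var_le u δ hb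
      have h1 := abs_softmaxMean_mul_le u hq
        (f := fun x => (δ x - softmaxMean u δ) ^ 2) fun x => (abs_of_nonneg (sq_nonneg _)).le
      have h2 : |softmaxMean u q| ≤ K := by
        simpa [softmaxMean_const] using abs_softmaxMean_mul_le u hq
          (f := fun _ => 1) (g := fun _ => 1) (by simp)
      have h3 : |softmaxMean u fun x => (δ x - softmaxMean u δ) ^ 2| ≤ b ^ 2 := by
        rw [abs_of_nonneg]
        · exact hv
        · exact Finset.sum_nonneg fun x _ => mul_nonneg (softmaxFun_pos u x).le (sq_nonneg _)
      refine (abs_sub _ _).trans ?_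
      rw [abs_mul]
      have h4 := mul_le_mul h2 h3 (abs_nonneg _) hK
      have h5 := mul_le_mul_of_nonneg_left hv hK
      linarith
  simpa [← hw] using this

/-- The second derivative of log-sum-exp along a line is the variance of the direction. -/
theorem abs_log_sum_exp_sub_sub_le {v w δ : X → ℝ} (hw : ∀ x, w x = v x + δ x) {b : ℝ}
    (hb : ∑ x, δ x ^ 2 ≤ b ^ 2) :
    |Real.log (∑ x, Real.exp (w x)) - Real.log (∑ x, Real.exp (v x)) - softmaxMean v δ|
      ≤ b ^ 2 := by
  have := abs_taylor_one_le (M := b ^ 2) (hasDerivAt_log_sum_exp v δ)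
    (hasDerivAt_softmaxMean v δ δ) fun τ => by
      set u := fun x => v x + τ * δ x
      have : softmaxCov u δ δ = softmaxMean u fun x => (δ x - softmaxMean u δ) ^ 2 := by
        rw [softmaxCov_eq, softmaxMean_sq_sub]
        have h2 : (fun x => δ x ^ 2) = fun x => δ x * δ x := by funext x; ring
        rw [h2]
        ring
      rw [this, abs_of_nonneg]
      · exact softmaxMean_var_le u δ hb
      · exact Finset.sum_nonneg fun x _ => mul_nonneg (softmaxFun_pos u x).le (sq_nonneg _)
  simpa [← hw] using this

end SoftmaxEstimates

/-! ### Consequences of a global quadratic remainder bound. -/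

section GradientDescent

variable {E : Type*} [NormedAddCommGroup E] [InnerProductSpace ℝ E]

/-- Makes separate differentiability arguments for the objective unnecessary: an explicit linear
part with quadratic error is already the gradient. -/
theorem hasGradientAt_of_quadratic_bound [CompleteSpace E] {f : E → ℝ} {g x : E} {B : ℝ}
    (h : ∀ δ, |f (x + δ) - f x - inner ℝ g δ| ≤ B * ‖δ‖ ^ 2) : HasGradientAt f g x := by
  rw [hasGradientAt_iff_isLittleO_nhds_zero]
  have h1 : (fun δ : E => f (x + δ) - f x - inner ℝ g δ) =O[nhds 0] fun δ => ‖δ‖ ^ 2 :=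
    Asymptotics.IsBigO.of_bound B (Filter.Eventually.of_forall fun δ => by simpa using h δ)
  exact h1.trans_isLittleO (Asymptotics.isLittleO_norm_pow_id one_lt_two)

theorem descent_of_quadratic_bound {f : E → ℝ} {g x : E} {s : ℝ} (hs : 0 < s)
    (h : ∀ δ, |f (x + δ) - f x - inner ℝ g δ| ≤ s / 2 * ‖δ‖ ^ 2) :
    f (x - (1 / s) • g) ≤ f x - 1 / (2 * s) * ‖g‖ ^ 2 := by
  have h1 := (abs_le.1 (h (-((1 / s) • g)))).2
  rw [← sub_eq_add_neg, inner_neg_right, real_inner_smul_right, real_inner_self_eq_norm_sq,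
    norm_neg, norm_smul, mul_pow, Real.norm_eq_abs, sq_abs] at h1
  have h2 : s / 2 * ((1 / s) ^ 2 * ‖g‖ ^ 2) = 1 / (2 * s) * ‖g‖ ^ 2 := by field_simp
  have h3 : 1 / s * ‖g‖ ^ 2 = 2 * (1 / (2 * s) * ‖g‖ ^ 2) := by field_simp
  linarith

end GradientDescent

/-! ### Discounted control: Bellman equations, performance difference, softmax smoothness and the
log barrier. -/

section DiscountedControl

open Matrix

variable {Z X : Type*} [Fintype Z] [DecidableEq Z] [Fintype X]

/-- The transition matrix of the chain controlled by the policy `p`. -/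
def policyMatrix (k : Z → X → Z → ℝ) (p : Z → X → ℝ) : Matrix Z Z ℝ :=
  Matrix.of fun z z' => ∑ x, p z x * k z x z'

/-- The value function of the policy `p` for the costs `c`. -/
noncomputable def policyValue (c : Z → X → ℝ) (k : Z → X → Z → ℝ) (γ : ℝ) (p : Z → X → ℝ) :
    Z → ℝ :=
  discountedResolvent γ (policyMatrix k p) *ᵥ fun z => ∑ x, p z x * c z x

/-- The action-value function of the policy `p`. -/
noncomputable def policyQ (c : Z → X → ℝ) (k : Z → X → Z → ℝ) (γ : ℝ) (p : Z → X → ℝ)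
    (z : Z) (x : X) : ℝ :=
  c z x + γ * ∑ z', k z x z' * policyValue c k γ p z'

/-- The measure on states, started from `m`, that counts visits with discounted weights. -/
noncomputable def discountedVisits (k : Z → X → Z → ℝ) (γ : ℝ) (p : Z → X → ℝ) (m : Z → ℝ) :
    Z → ℝ :=
  m ᵥ* discountedResolvent γ (policyMatrix k p)

variable {c : Z → X → ℝ} {k : Z → X → Z → ℝ} {γ K : ℝ} {p : Z → X → ℝ}

omit [DecidableEq Z] in
theorem policyMatrix_mulVec (v : Z → ℝ) (z : Z) :
    (policyMatrix k p *ᵥ v) z = ∑ x, p z x * ∑ z', k z x z' * v z' := by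
  simp only [policyMatrix, mulVec, dotProduct, of_apply, Finset.sum_mul, Finset.mul_sum]
  rw [Finset.sum_comm]
  exact Finset.sum_congr rfl fun _ _ => Finset.sum_congr rfl fun _ _ => by ring

theorem policyMatrix_mem (hk : ∀ z x, k z x ∈ stdSimplex ℝ Z) (hp : ∀ z, p z ∈ stdSimplex ℝ X) :
    policyMatrix k p ∈ rowStochastic ℝ Z := by
  refine ⟨fun z z' => Finset.sum_nonneg fun x _ => mul_nonneg ((hp z).1 x) ((hk z x).1 z'), ?_⟩
  funext z
  rw [policyMatrix_mulVec]
  simp [(hk z _).2, (hp z).2]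

theorem sum_mul_le_of_mem_stdSimplex {Y : Type*} [Fintype Y] {f v : Y → ℝ}
    (hf : f ∈ stdSimplex ℝ Y) {a : ℝ} (h : ∀ y, v y ≤ a) : ∑ y, f y * v y ≤ a := by
  calc ∑ y, f y * v y ≤ ∑ y, f y * a :=
        Finset.sum_le_sum fun y _ => mul_le_mul_of_nonneg_left (h y) (hf.1 y)
    _ = a := by rw [← Finset.sum_mul, hf.2, one_mul]

theorem sum_mul_nonneg_of_mem_stdSimplex {Y : Type*} [Fintype Y] {f v : Y → ℝ}
    (hf : f ∈ stdSimplex ℝ Y) (h : ∀ y, 0 ≤ v y) : 0 ≤ ∑ y, f y * v y :=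
  Finset.sum_nonneg fun y _ => mul_nonneg (hf.1 y) (h y)

theorem abs_sum_mul_le_of_mem_stdSimplex {Y : Type*} [Fintype Y] {f v : Y → ℝ}
    (hf : f ∈ stdSimplex ℝ Y) {a : ℝ} (h : ∀ y, |v y| ≤ a) : |∑ y, f y * v y| ≤ a := by
  refine (Finset.abs_sum_le_sum_abs _ _).trans ?_
  simp only [abs_mul, abs_of_nonneg (hf.1 _)]
  exact sum_mul_le_of_mem_stdSimplex hf h

section Bellman

variable (hk : ∀ z x, k z x ∈ stdSimplex ℝ Z) (hp : ∀ z, p z ∈ stdSimplex ℝ X) (h0 : 0 ≤ γ)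
  (h1 : γ < 1)
include hk hp h0 h1

theorem policyValue_eq (z : Z) :
    policyValue c k γ p z = ∑ x, p z x * policyQ c k γ p z x := by
  rw [policyValue, discountedResolvent_mulVec (policyMatrix_mem hk hp) h0 h1, policyMatrix_mulVec]
  simp only [policyQ, mul_add, Finset.sum_add_distrib]
  congr 1
  rw [Finset.mul_sum]
  exact Finset.sum_congr rfl fun x _ => by rw [policyValue]; ring

theorem eq_policyValue {W : Z → ℝ}
    (h : ∀ z, W z = ∑ x, p z x * (c z x + γ * ∑ z', k z x z' * W z')) :
    W = policyValue c k γ p := by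
  refine eq_discountedResolvent_mulVec (policyMatrix_mem hk hp) h0 h1 fun z => ?_
  rw [h z, policyMatrix_mulVec]
  simp only [mul_add, Finset.sum_add_distrib]
  congr 1
  rw [Finset.mul_sum]
  exact Finset.sum_congr rfl fun x _ => by ring

theorem policyValue_nonneg (hc : ∀ z x, 0 ≤ c z x) (z : Z) : 0 ≤ policyValue c k γ p z :=
  nonneg_of_eq_add_discounted (policyMatrix_mem hk hp) h0 h1
    (discountedResolvent_mulVec (policyMatrix_mem hk hp) h0 h1 _)
    (fun z => sum_mul_nonneg_of_mem_stdSimplex (hp z) (hc z)) z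

theorem policyValue_le (hc : ∀ z x, c z x ≤ K) (z : Z) :
    policyValue c k γ p z ≤ K / (1 - γ) := by
  refine le_div_of_le_add_discounted (policyMatrix_mem hk hp) h0 h1 (fun z => ?_) z
  rw [policyValue, discountedResolvent_mulVec (policyMatrix_mem hk hp) h0 h1]
  gcongr
  exact sum_mul_le_of_mem_stdSimplex (hp z) (hc z)

theorem abs_policyQ_le (hc : ∀ z x, 0 ≤ c z x) (hc' : ∀ z x, c z x ≤ K) (z : Z) (x : X) :
    |policyQ c k γ p z x| ≤ K / (1 - γ) := by
  have h2 := sum_mul_nonneg_of_mem_stdSimplex (hk z x) (policyValue_nonneg hk hp h0 h1 hc)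
  have h3 := sum_mul_le_of_mem_stdSimplex (hk z x) (policyValue_le hk hp h0 h1 hc')
  have hq : policyQ c k γ p z x = c z x + γ * ∑ z', k z x z' * policyValue c k γ p z' := rfl
  rw [hq, abs_of_nonneg (add_nonneg (hc z x) (mul_nonneg h0 h2))]
  have h4 : K / (1 - γ) = K + γ * (K / (1 - γ)) := by
    have : (1 - γ) ≠ 0 := by linarith
    field_simp
    ring
  rw [h4]
  gcongr
  exact hc' z x

omit hp in
/-- The performance difference identity. -/
theorem sum_mul_policyValue_sub {q : Z → X → ℝ} (hq : ∀ z, q z ∈ stdSimplex ℝ X) (m : Z → ℝ) :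
    ∑ z, m z * policyValue c k γ p z - ∑ z, m z * policyValue c k γ q z
      = ∑ z, discountedVisits k γ q m z *
          ∑ x, q z x * (policyValue c k γ p z - policyQ c k γ p z x) := by
  have h : policyValue c k γ p - policyValue c k γ q
      = discountedResolvent γ (policyMatrix k q) *ᵥ fun z =>
          ∑ x, q z x * (policyValue c k γ p z - policyQ c k γ p z x) := by
    -- The difference of values solves the Bellman equation of `q` with the negated advantages of
    -- `p` as costs. Moving the resolvent onto `m` afterwards produces the visits of `q`.
    refine eq_discountedResolvent_mulVec (policyMatrix_mem hk hq) h0 h1 fun z => ?_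
    have h2 : ∑ x, q z x * (policyValue c k γ p z - policyQ c k γ p z x)
        = policyValue c k γ p z - ∑ x, q z x * policyQ c k γ p z x := by
      simp only [mul_sub, Finset.sum_sub_distrib, ← Finset.sum_mul, (hq z).2, one_mul]
    rw [h2, Pi.sub_apply, policyValue_eq hk hq h0 h1, policyMatrix_mulVec]
    simp only [policyQ, mul_add, mul_sub, Pi.sub_apply, Finset.sum_add_distrib,
      Finset.sum_sub_distrib, Finset.mul_sum]
    simp only [mul_left_comm γ]
    ring
  rw [← Finset.sum_sub_distrib]
  simp only [← mul_sub, discountedVisits]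
  change m ⬝ᵥ (policyValue c k γ p - policyValue c k γ q) = _ ⬝ᵥ _
  rw [h, dotProduct_mulVec]

end Bellman

section SoftmaxPolicy

variable [Nonempty X] {θ θ' δ : Z → X → ℝ} {b : ℝ}

/-- The tabular softmax policy. -/
noncomputable def tabularSoftmax (θ : Z → X → ℝ) (z : Z) : X → ℝ := softmaxFun (θ z)

omit [Fintype Z] [DecidableEq Z] in
theorem tabularSoftmax_mem (θ : Z → X → ℝ) (z : Z) : tabularSoftmax θ z ∈ stdSimplex ℝ X :=
  softmaxFun_mem _

/-- The linear part of the value function of the softmax policy. -/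
noncomputable def valueDeriv (c : Z → X → ℝ) (k : Z → X → Z → ℝ) (γ : ℝ) (θ δ : Z → X → ℝ) :
    Z → ℝ :=
  discountedResolvent γ (policyMatrix k (tabularSoftmax θ)) *ᵥ
    fun z => softmaxCov (θ z) (policyQ c k γ (tabularSoftmax θ) z) (δ z)

/-- Both the difference `V' - V` and the remainder `V' - V - G` solve Bellman equations, so their
sizes follow from their source terms at the price of one factor `1 / (1 - γ)` each. -/
theorem abs_policyValue_sub_sub_le (hk : ∀ z x, k z x ∈ stdSimplex ℝ Z) (h0 : 0 ≤ γ) (h1 : γ < 1)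
    (hc : ∀ z x, 0 ≤ c z x) (hc' : ∀ z x, c z x ≤ K) (hK : 0 ≤ K)
    (hθ : ∀ z x, θ' z x = θ z x + δ z x) (hb0 : 0 ≤ b) (hb : ∀ z, ∑ x, δ z x ^ 2 ≤ b ^ 2) (z : Z) :
    |policyValue c k γ (tabularSoftmax θ') z - policyValue c k γ (tabularSoftmax θ) z
      - valueDeriv c k γ θ δ z| ≤ 2 * K / (1 - γ) ^ 3 * b ^ 2 := by
  have hg : 0 < 1 - γ := by linarith
  set V' := policyValue c k γ (tabularSoftmax θ') with hV'
  set V := policyValue c k γ (tabularSoftmax θ) with hV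
  set Q := policyQ c k γ (tabularSoftmax θ) with hQ
  set G := valueDeriv c k γ θ δ with hG
  have hP := policyMatrix_mem hk (tabularSoftmax_mem θ)
  have hP' := policyMatrix_mem hk (tabularSoftmax_mem θ')
  have hQb : ∀ z x, |Q z x| ≤ K / (1 - γ) :=
    abs_policyQ_le hk (tabularSoftmax_mem θ) h0 h1 hc hc'
  have hK1 : 0 ≤ K / (1 - γ) := by positivity
  -- Under the new chain the source is the change of the mean of the old `Q`, which is of first
  -- order in `b`.
  have hD : ∀ z, (V' - V) z = (softmaxMean (θ' z) (Q z) - softmaxMean (θ z) (Q z))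
      + γ * (policyMatrix k (tabularSoftmax θ') *ᵥ (V' - V)) z := fun z => by
    rw [Pi.sub_apply, hV', hV, policyValue_eq hk (tabularSoftmax_mem θ') h0 h1,
      policyValue_eq hk (tabularSoftmax_mem θ) h0 h1, ← hV', ← hV, policyMatrix_mulVec,
      softmaxMean, softmaxMean]
    have : ∀ x, tabularSoftmax θ' z x * policyQ c k γ (tabularSoftmax θ') z x
        = softmaxFun (θ' z) x * Q z x
          + γ * (tabularSoftmax θ' z x * ∑ z', k z x z' * (V' - V) z') := fun x => by
      simp only [hQ, policyQ, ← hV', ← hV, Pi.sub_apply, mul_sub, Finset.sum_sub_distrib,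
        tabularSoftmax]
      ring
    rw [Finset.sum_congr rfl fun x _ => this x, Finset.sum_add_distrib, ← Finset.mul_sum]
    simp only [tabularSoftmax, hQ]
    ring
  have hDb : ∀ z, |(V' - V) z| ≤ K / (1 - γ) * b / (1 - γ) :=
    abs_le_div_of_eq_add_discounted hP' h0 h1 hD fun z =>
      abs_softmaxMean_sub_le (hθ z) (hQb z) hK1 hb0 (hb z)
  -- Under the old chain the source is the second-order softmax remainder plus `γ (P' - P)(V' - V)`,
  -- a product of two first-order quantities.
  have hR : ∀ z, (V' - V - G) z
      = ((softmaxMean (θ' z) (Q z) - softmaxMean (θ z) (Q z) - softmaxCov (θ z) (Q z) (δ z))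
        + γ * (softmaxMean (θ' z) (fun x => ∑ z', k z x z' * (V' - V) z')
          - softmaxMean (θ z) (fun x => ∑ z', k z x z' * (V' - V) z')))
      + γ * (policyMatrix k (tabularSoftmax θ) *ᵥ (V' - V - G)) z := fun z => by
    have h2 := discountedResolvent_mulVec hP h0 h1
      (fun z => softmaxCov (θ z) (policyQ c k γ (tabularSoftmax θ) z) (δ z)) z
    change G z = _ + γ * (_ *ᵥ G) z at h2
    have h3 : (policyMatrix k (tabularSoftmax θ) *ᵥ (V' - V - G)) z
        = (policyMatrix k (tabularSoftmax θ) *ᵥ (V' - V)) z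
          - (policyMatrix k (tabularSoftmax θ) *ᵥ G) z := by
      rw [mulVec_sub, Pi.sub_apply]
    rw [Pi.sub_apply, hD z, h2, h3, policyMatrix_mulVec (V' - V), policyMatrix_mulVec (V' - V)]
    simp only [softmaxMean, tabularSoftmax, hQ]
    ring
  have hfin := abs_le_div_of_eq_add_discounted hP h0 h1 hR
    (R := 2 * (K / (1 - γ)) * b ^ 2 + γ * (K / (1 - γ) * b / (1 - γ) * b)) (fun z => by
      refine (abs_add_le _ _).trans (add_le_add
        (abs_softmaxMean_sub_sub_le (hθ z) (hQb z) hK1 (hb z)) ?_)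
      rw [abs_mul, abs_of_nonneg h0]
      exact mul_le_mul_of_nonneg_left (abs_softmaxMean_sub_le (hθ z)
        (fun x => abs_sum_mul_le_of_mem_stdSimplex (hk z x) hDb) (by positivity) hb0 (hb z)) h0) z
  refine hfin.trans ?_
  have h3 : (2 * (K / (1 - γ)) * b ^ 2 + γ * (K / (1 - γ) * b / (1 - γ) * b)) / (1 - γ)
      = (2 - γ) * K / (1 - γ) ^ 3 * b ^ 2 := by
    field_simp
    ring
  rw [h3]
  gcongr
  linarith

/-- The derivative of the regularized objective in the coordinate `(z, x)`. -/
noncomputable def barrierGradient (c : Z → X → ℝ) (k : Z → X → Z → ℝ) (γ : ℝ) (m w : Z → ℝ)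
    (κ : ℝ) (θ : Z → X → ℝ) (z : Z) (x : X) : ℝ :=
  discountedVisits k γ (tabularSoftmax θ) m z * (tabularSoftmax θ z x *
      (policyQ c k γ (tabularSoftmax θ) z x - policyValue c k γ (tabularSoftmax θ) z))
    + κ * w z * (tabularSoftmax θ z x - 1 / (Fintype.card X : ℝ))

/-- The regularized objective for the initial weights `m` and the barrier weights `w`. -/
noncomputable def barrierObjective (c : Z → X → ℝ) (k : Z → X → Z → ℝ) (γ : ℝ) (m w : Z → ℝ)
    (κ : ℝ) (θ : Z → X → ℝ) : ℝ :=
  ∑ z, m z * policyValue c k γ (tabularSoftmax θ) z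
    + κ * ∑ z, w z * finKL (unifDist X) (tabularSoftmax θ z)

/-- The barrier is log-sum-exp up to an affine function of the parameters, so its remainder is that
of log-sum-exp. -/
theorem finKL_unifDist_softmaxFun (v : X → ℝ) :
    finKL (unifDist X) (softmaxFun v)
      = Real.log (∑ x, Real.exp (v x)) - 1 / (Fintype.card X : ℝ) * ∑ x, v x
        - Real.log (Fintype.card X) := by
  have hN : (0 : ℝ) < Fintype.card X := by exact_mod_cast Fintype.card_pos
  have h : ∀ x, -Real.log (softmaxFun v x / (1 / (Fintype.card X : ℝ)))
      = (Real.log (∑ x, Real.exp (v x)) - Real.log (Fintype.card X)) - v x := fun x => by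
    rw [Real.log_div (softmaxFun_pos v x).ne' (by positivity), softmaxFun_eq_exp, Real.log_exp,
      one_div, Real.log_inv]
    ring
  simp only [finKL, unifDist, h]
  rw [← Finset.mul_sum, Finset.sum_sub_distrib, Finset.sum_const, Finset.card_univ, nsmul_eq_mul]
  field_simp
  ring

theorem finKL_unifDist_nonneg {q : X → ℝ} (hq : q ∈ stdSimplex ℝ X) (hpos : ∀ x, 0 < q x) :
    0 ≤ finKL (unifDist X) q := by
  have hN : (0 : ℝ) < Fintype.card X := by exact_mod_cast Fintype.card_pos
  have h : ∀ x, 1 / (Fintype.card X : ℝ) * (1 - q x / (1 / (Fintype.card X : ℝ)))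
      = 1 / (Fintype.card X : ℝ) - q x := fun x => by field_simp
  calc (0 : ℝ) = ∑ x, (1 / (Fintype.card X : ℝ) - q x) := by
        rw [Finset.sum_sub_distrib, hq.2, Finset.sum_const, Finset.card_univ, nsmul_eq_mul]
        field_simp
        ring
    _ ≤ _ := by
      refine Finset.sum_le_sum fun x _ => ?_
      rw [← h, unifDist]
      gcongr
      linarith [Real.log_le_sub_one_of_pos (show 0 < q x / (1 / (Fintype.card X : ℝ)) by
        have := hpos x
        positivity)]

theorem finKL_unifDist_eq {q : X → ℝ} (hpos : ∀ x, 0 < q x) :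
    finKL (unifDist X) q
      = 1 / (Fintype.card X : ℝ) * ∑ x, -Real.log (q x) - Real.log (Fintype.card X) := by
  have hN : (0 : ℝ) < Fintype.card X := by exact_mod_cast Fintype.card_pos
  have h : ∀ x, -Real.log (q x / (1 / (Fintype.card X : ℝ)))
      = -Real.log (q x) - Real.log (Fintype.card X) := fun x => by
    rw [Real.log_div (hpos x).ne' (by positivity), one_div, Real.log_inv]
    ring
  simp only [finKL, unifDist, h]
  rw [← Finset.mul_sum, Finset.sum_sub_distrib, Finset.sum_const, Finset.card_univ, nsmul_eq_mul]
  field_simp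

theorem finKL_unifDist_le {q : X → ℝ} {l : ℝ} (hl : 0 < l) (hlq : ∀ x, l ≤ q x) :
    finKL (unifDist X) q ≤ -Real.log l := by
  have hN : (1 : ℝ) ≤ Fintype.card X := by exact_mod_cast Fintype.card_pos
  rw [finKL_unifDist_eq fun x => hl.trans_le (hlq x)]
  have h : ∑ x, -Real.log (q x) ≤ ∑ _x : X, -Real.log l :=
    Finset.sum_le_sum fun x _ => neg_le_neg (Real.log_le_log hl (hlq x))
  rw [Finset.sum_const, Finset.card_univ, nsmul_eq_mul] at h
  have h2 : 1 / (Fintype.card X : ℝ) * ∑ x, -Real.log (q x) ≤ -Real.log l := by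
    rw [one_div, inv_mul_le_iff₀ (by linarith)]
    exact h
  linarith [Real.log_nonneg hN]

/-- All terms `-log (q y)` are nonnegative, so a bound on their sum bounds each of them. -/
theorem exp_le_of_finKL_unifDist_le {q : X → ℝ} (hq : q ∈ stdSimplex ℝ X) (hpos : ∀ x, 0 < q x)
    {B : ℝ} (hB : finKL (unifDist X) q ≤ B) (x : X) :
    Real.exp (-(Fintype.card X * (B + Real.log (Fintype.card X)))) ≤ q x := by
  have hN : (0 : ℝ) < Fintype.card X := by exact_mod_cast Fintype.card_pos
  have hone : ∀ y, q y ≤ 1 := fun y => by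
    rw [← hq.2]
    exact Finset.single_le_sum (fun y _ => hq.1 y) (Finset.mem_univ y)
  rw [finKL_unifDist_eq hpos] at hB
  have h : -Real.log (q x) ≤ ∑ y, -Real.log (q y) :=
    Finset.single_le_sum (f := fun y => -Real.log (q y))
      (fun y _ => neg_nonneg.2 (Real.log_nonpos (hpos y).le (hone y))) (Finset.mem_univ x)
  have h2 : ∑ y, -Real.log (q y) ≤ Fintype.card X * (B + Real.log (Fintype.card X)) := by
    rw [← inv_mul_le_iff₀ hN, ← one_div]
    linarith
  rw [← Real.le_log_iff_exp_le (hpos x)]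
  linarith

theorem abs_barrierObjective_sub_sub_le (hk : ∀ z x, k z x ∈ stdSimplex ℝ Z) (h0 : 0 ≤ γ)
    (h1 : γ < 1) (hc : ∀ z x, 0 ≤ c z x) (hc' : ∀ z x, c z x ≤ K) (hK : 0 ≤ K) {m w : Z → ℝ}
    {κ a : ℝ} (hm : m ∈ stdSimplex ℝ Z) (hw : ∀ z, 0 ≤ w z) (hwa : ∑ z, w z = a) (hκ : 0 ≤ κ)
    (hθ : ∀ z x, θ' z x = θ z x + δ z x) (hb0 : 0 ≤ b) (hb : ∀ z, ∑ x, δ z x ^ 2 ≤ b ^ 2) :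
    |barrierObjective c k γ m w κ θ' - barrierObjective c k γ m w κ θ
        - ∑ z, ∑ x, barrierGradient c k γ m w κ θ z x * δ z x|
      ≤ (2 * K / (1 - γ) ^ 3 + κ * a) * b ^ 2 := by
  set V' := policyValue c k γ (tabularSoftmax θ') with hV'
  set V := policyValue c k γ (tabularSoftmax θ) with hV
  set l : (X → ℝ) → ℝ := fun v => Real.log (∑ x, Real.exp (v x)) with hl
  have hKL : ∀ z, finKL (unifDist X) (tabularSoftmax θ' z)
      - finKL (unifDist X) (tabularSoftmax θ z)
      = (l (θ' z) - l (θ z) - softmaxMean (θ z) (δ z))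
        + ∑ x, (tabularSoftmax θ z x - 1 / (Fintype.card X : ℝ)) * δ z x := fun z => by
    rw [tabularSoftmax, tabularSoftmax, finKL_unifDist_softmaxFun, finKL_unifDist_softmaxFun]
    simp only [hθ z, sub_mul, Finset.sum_sub_distrib, Finset.sum_add_distrib, softmaxMean,
      ← Finset.mul_sum, hl]
    ring
  -- The policy gradient formula: transposing the resolvent turns the initial weights into visits,
  -- and each covariance is a sum of advantages against `δ`.
  have hval : ∑ z, m z * valueDeriv c k γ θ δ z = ∑ z, ∑ x,
      discountedVisits k γ (tabularSoftmax θ) m z * (tabularSoftmax θ z x *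
        (policyQ c k γ (tabularSoftmax θ) z x - V z)) * δ z x := by
    change m ⬝ᵥ valueDeriv c k γ θ δ = _
    rw [valueDeriv, dotProduct_mulVec]
    change ∑ z, discountedVisits k γ (tabularSoftmax θ) m z * _ = _
    refine Finset.sum_congr rfl fun z _ => ?_
    have h2 : ∀ x, discountedVisits k γ (tabularSoftmax θ) m z * (tabularSoftmax θ z x *
          (policyQ c k γ (tabularSoftmax θ) z x - V z)) * δ z x
        = discountedVisits k γ (tabularSoftmax θ) m z * (softmaxFun (θ z) x *
            (policyQ c k γ (tabularSoftmax θ) z x * δ z x))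
          - discountedVisits k γ (tabularSoftmax θ) m z * V z * (softmaxFun (θ z) x * δ z x) :=
      fun x => by rw [tabularSoftmax]; ring
    rw [Finset.sum_congr rfl fun x _ => h2 x, Finset.sum_sub_distrib, ← Finset.mul_sum,
      ← Finset.mul_sum, softmaxCov_eq, hV, policyValue_eq hk (tabularSoftmax_mem θ) h0 h1]
    simp only [softmaxMean, tabularSoftmax]
    ring
  have hmain : barrierObjective c k γ m w κ θ' - barrierObjective c k γ m w κ θ
        - ∑ z, ∑ x, barrierGradient c k γ m w κ θ z x * δ z x
      = ∑ z, m z * (V' z - V z - valueDeriv c k γ θ δ z)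
        + κ * ∑ z, w z * (l (θ' z) - l (θ z) - softmaxMean (θ z) (δ z)) := by
    have h2 : ∀ z, w z * (l (θ' z) - l (θ z) - softmaxMean (θ z) (δ z))
        = w z * finKL (unifDist X) (tabularSoftmax θ' z)
          - w z * finKL (unifDist X) (tabularSoftmax θ z)
          - ∑ x, w z * (tabularSoftmax θ z x - 1 / (Fintype.card X : ℝ)) * δ z x := fun z => by
      simp only [mul_assoc, ← Finset.mul_sum]
      linear_combination -w z * hKL z
    simp only [h2, barrierObjective, barrierGradient, add_mul, Finset.sum_add_distrib, mul_sub,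
      Finset.sum_sub_distrib, ← hV, ← hV'] at hval ⊢
    rw [hval]
    simp only [Finset.mul_sum, mul_assoc, mul_sub, sub_mul, Finset.sum_sub_distrib]
    ring
  rw [hmain, add_mul]
  refine (abs_add_le _ _).trans (add_le_add ?_ ?_)
  · exact abs_sum_mul_le_of_mem_stdSimplex hm
      (abs_policyValue_sub_sub_le hk h0 h1 hc hc' hK hθ hb0 hb)
  · rw [abs_mul, abs_of_nonneg hκ, mul_assoc, ← hwa]
    refine mul_le_mul_of_nonneg_left ((Finset.abs_sum_le_sum_abs _ _).trans ?_) hκ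
    rw [Finset.sum_mul]
    refine Finset.sum_le_sum fun z _ => ?_
    rw [abs_mul, abs_of_nonneg (hw z)]
    exact mul_le_mul_of_nonneg_left (abs_log_sum_exp_sub_sub_le (hθ z) (hb z)) (hw z)

/-- At an almost stationary point of the regularized objective no action has a large advantage. -/
theorem neg_le_visits_mul_advantage {m w : Z → ℝ} {κ : ℝ} {z : Z} {x : X}
    (hg : |barrierGradient c k γ m w κ θ z x| ≤ κ * w z / (Fintype.card X : ℝ)) :
    -(κ * w z) ≤ discountedVisits k γ (tabularSoftmax θ) m z *
      (policyQ c k γ (tabularSoftmax θ) z x - policyValue c k γ (tabularSoftmax θ) z) := by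
  have hp : 0 < tabularSoftmax θ z x := softmaxFun_pos _ _
  have h2 := (abs_le.1 hg).1
  rw [barrierGradient] at h2
  -- The admitted gradient size equals the uniform part of the barrier gradient. These cancel, and
  -- what remains carries the factor `tabularSoftmax θ z x`, which is divided out.
  refine le_of_mul_le_mul_left ?_ hp
  have h3 : κ * w z / (Fintype.card X : ℝ) = κ * w z * (1 / (Fintype.card X : ℝ)) := by ring
  rw [h3] at h2
  linarith

end SoftmaxPolicy

end DiscountedControl

/-! ### The two-stage problem as one discounted problem, and gradient domination. -/

namespace RiskMDP

open Matrix

variable {S A : Type*} [Fintype S] [DecidableEq S] [Fintype A] {H : ℕ}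

/-- The costs of the two stages, on the disjoint union of their state spaces. -/
noncomputable def augCost (M : RiskMDP S A) : S ⊕ (S × EtaGrid H) → A × EtaGrid H → ℝ :=
  Sum.elim (fun s x => M.cost s x.1 + M.γ * M.lam * etaVal x.2) M.laterCost

/-- The transition kernel on the disjoint union of the state spaces of the two stages. -/
def augKernel (M : RiskMDP S A) (y : S ⊕ (S × EtaGrid H)) (x : A × EtaGrid H) :
    S ⊕ (S × EtaGrid H) → ℝ :=
  Sum.elim (fun _ => 0) fun z => if z.2 = x.2 then M.P (Sum.elim id Prod.fst y) x.1 z.1 else 0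

/-- The two stages of a policy, on the disjoint union of their state spaces. -/
def augPolicy (π : RiskPolicy S A H) : S ⊕ (S × EtaGrid H) → A × EtaGrid H → ℝ :=
  Sum.elim π.one π.two

/-- The parameters `θ = (θ₁, θ₂)` as one table. -/
def augParam (θ : RiskParam S A H) : S ⊕ (S × EtaGrid H) → A × EtaGrid H → ℝ :=
  Sum.elim (fun s x => θ (Sum.inl (s, x))) fun z x => θ (Sum.inr (z, x))

/-- The weights of the barrier terms. -/
noncomputable def augWeight (S : Type*) [Fintype S] (H : ℕ) : S ⊕ (S × EtaGrid H) → ℝ :=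
  Sum.elim (unifDist S) (unifDist (S × EtaGrid H))

omit [DecidableEq S] [Fintype A] in
theorem sum_augKernel_mul (M : RiskMDP S A) (y : S ⊕ (S × EtaGrid H)) (x : A × EtaGrid H)
    (v : S ⊕ (S × EtaGrid H) → ℝ) :
    ∑ y', M.augKernel y x y' * v y'
      = ∑ s', M.P (Sum.elim id Prod.fst y) x.1 s' * v (Sum.inr (s', x.2)) := by
  rw [Fintype.sum_sum_type]
  simp [augKernel, Fintype.sum_prod_type]

omit [DecidableEq S] [Fintype A] in
theorem augKernel_mem (M : RiskMDP S A) (y : S ⊕ (S × EtaGrid H)) (x : A × EtaGrid H) :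
    M.augKernel y x ∈ stdSimplex ℝ (S ⊕ (S × EtaGrid H)) := by
  constructor
  · rintro (s | z)
    · exact le_rfl
    · simp only [augKernel, Sum.elim_inr]
      split_ifs
      · exact (M.P_mem _ _).1 _
      · exact le_rfl
  · have := M.sum_augKernel_mul y x fun _ => 1
    simp only [mul_one, (M.P_mem _ _).2] at this
    exact this

omit [Fintype S] [DecidableEq S] in
theorem augPolicy_mem (π : RiskPolicy S A H) (y : S ⊕ (S × EtaGrid H)) :
    augPolicy π y ∈ stdSimplex ℝ (A × EtaGrid H) := by
  rcases y with s | z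
  · exact π.one_mem s
  · exact π.two_mem z

omit [DecidableEq S] in
theorem policyMatrix_augKernel_inl (M : RiskMDP S A)
    (p : S ⊕ (S × EtaGrid H) → A × EtaGrid H → ℝ) (y : S ⊕ (S × EtaGrid H)) (s : S) :
    policyMatrix M.augKernel p y (Sum.inl s) = 0 := by
  simp [policyMatrix, augKernel]

omit [DecidableEq S] in
theorem policyMatrix_augKernel_inr (M : RiskMDP S A)
    (p : S ⊕ (S × EtaGrid H) → A × EtaGrid H → ℝ) (y : S ⊕ (S × EtaGrid H)) (z : S × EtaGrid H) :
    policyMatrix M.augKernel p y (Sum.inr z)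
      = ∑ a, p y (a, z.2) * M.P (Sum.elim id Prod.fst y) a z.1 := by
  simp [policyMatrix, augKernel, Fintype.sum_prod_type]

omit [DecidableEq S] in
theorem transMatrix_mulVec (M : RiskMDP S A) (π : RiskPolicy S A H) (v : S × EtaGrid H → ℝ)
    (z : S × EtaGrid H) :
    (M.transMatrix π *ᵥ v) z = ∑ x, π.two z x * ∑ s', M.P z.1 x.1 s' * v (s', x.2) := by
  simp only [mulVec, dotProduct, transMatrix, of_apply, Fintype.sum_prod_type, Finset.sum_mul,
    Finset.mul_sum]
  rw [Finset.sum_comm, Finset.sum_comm (s := (Finset.univ : Finset A))]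
  refine Finset.sum_congr rfl fun e _ => ?_
  rw [Finset.sum_comm]
  exact Finset.sum_congr rfl fun _ _ => Finset.sum_congr rfl fun _ _ => by ring

theorem transMatrix_mem (M : RiskMDP S A) (π : RiskPolicy S A H) :
    M.transMatrix π ∈ rowStochastic ℝ (S × EtaGrid H) := by
  refine ⟨fun z z' => Finset.sum_nonneg fun a _ =>
    mul_nonneg ((π.two_mem z).1 _) ((M.P_mem _ _).1 _), ?_⟩
  funext z
  rw [transMatrix_mulVec]
  simp [(M.P_mem _ _).2, (π.two_mem z).2]

theorem laterValue_eq_mulVec (M : RiskMDP S A) (π : RiskPolicy S A H) :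
    M.laterValue π = discountedResolvent M.γ (M.transMatrix π) *ᵥ M.stepCost π := by
  funext z
  exact tsum_discounted_eq (M.transMatrix_mem π) M.γ_mem.1.le M.γ_mem.2 _ z

theorem visitFrom_eq (M : RiskMDP S A) (π : RiskPolicy S A H) (z₂ z : S × EtaGrid H) :
    M.visitFrom π z₂ z = (1 - M.γ) * discountedResolvent M.γ (M.transMatrix π) z₂ z := by
  have := tsum_discounted_eq (M.transMatrix_mem π) M.γ_mem.1.le M.γ_mem.2 (Pi.single z 1) z₂
  simp only [mulVec_single_one, col_apply] at this
  rw [visitFrom, this]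

/-- The two-stage values satisfy the Bellman equation on the union, which has a unique solution. -/
theorem policyValue_aug (M : RiskMDP S A) (π : RiskPolicy S A H) :
    policyValue M.augCost M.augKernel M.γ (augPolicy π)
      = Sum.elim (fun s => ∑ x, π.one s x * M.firstQ π s x) (M.laterValue π) := by
  refine (eq_policyValue M.augKernel_mem (augPolicy_mem π) M.γ_mem.1.le M.γ_mem.2 ?_).symm
  rintro (s | z)
  · simp only [sum_augKernel_mul, augPolicy, augCost, firstQ, Sum.elim_inl, Sum.elim_inr, id]
  · simp only [sum_augKernel_mul, augPolicy, augCost, Sum.elim_inr]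
    rw [laterValue_eq_mulVec, discountedResolvent_mulVec (M.transMatrix_mem π) M.γ_mem.1.le
      M.γ_mem.2, transMatrix_mulVec]
    simp only [mul_add, Finset.sum_add_distrib, stepCost]
    congr 1
    rw [Finset.mul_sum]
    exact Finset.sum_congr rfl fun x _ => by ring

theorem J_eq (M : RiskMDP S A) (π : RiskPolicy S A H) (ρ : S → ℝ) :
    M.J π ρ = ∑ y, Sum.elim ρ (fun _ => 0) y
      * policyValue M.augCost M.augKernel M.γ (augPolicy π) y := by
  rw [policyValue_aug, Fintype.sum_sum_type]
  simp [J]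

/-- First-stage states are occupied only at the start. The second stage is entered one step later,
hence the factor `γ`; the `1 / (1 - γ)` undoes the normalization of `visit`. -/
theorem discountedVisits_aug (M : RiskMDP S A) (π : RiskPolicy S A H) (ρ : S → ℝ) :
    discountedVisits M.augKernel M.γ (augPolicy π) (Sum.elim ρ fun _ => 0)
      = Sum.elim ρ fun z => M.γ / (1 - M.γ) * M.visit π ρ z := by
  have hγ : (1 - M.γ) ≠ 0 := by linarith [M.γ_mem.2]
  have hv : ∀ z, M.γ / (1 - M.γ) * M.visit π ρ z
      = M.γ * (M.secondDist π ρ ᵥ* discountedResolvent M.γ (M.transMatrix π)) z := fun z => by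
    simp only [visit, visitFrom_eq, vecMul, dotProduct, Finset.mul_sum]
    refine Finset.sum_congr rfl fun z₂ _ => ?_
    field_simp
  refine (eq_vecMul_discountedResolvent (policyMatrix_mem M.augKernel_mem (augPolicy_mem π))
    M.γ_mem.1.le M.γ_mem.2 ?_).symm
  rintro (s | z)
  · simp [vecMul, dotProduct, policyMatrix_augKernel_inl]
  · simp only [Sum.elim_inr, vecMul, dotProduct, Fintype.sum_sum_type, Sum.elim_inl, hv,
      policyMatrix_augKernel_inr, augPolicy, id, zero_add]
    rw [mul_eq_mul_left_iff]
    left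
    change (M.secondDist π ρ ᵥ* discountedResolvent M.γ (M.transMatrix π)) z = _
    conv_lhs => rw [discountedResolvent_eq_right (M.transMatrix_mem π) M.γ_mem.1.le M.γ_mem.2,
      vecMul_add, vecMul_one, vecMul_smul, Pi.add_apply, Pi.smul_apply, smul_eq_mul,
      ← vecMul_vecMul]
    congr 1
    generalize discountedResolvent M.γ (M.transMatrix π) = R
    simp only [vecMul, dotProduct, transMatrix, of_apply]
    rw [Finset.mul_sum]
    exact Finset.sum_congr rfl fun x _ => by ring

theorem le_discountedVisits_inl (M : RiskMDP S A)
    {p : S ⊕ (S × EtaGrid H) → A × EtaGrid H → ℝ} (hp : ∀ y, p y ∈ stdSimplex ℝ (A × EtaGrid H))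
    {μ : S → ℝ} (hμ : ∀ s, 0 ≤ μ s) (s : S) :
    μ s ≤ discountedVisits M.augKernel M.γ p (Sum.elim μ fun _ => 0) (Sum.inl s) := by
  have h := add_vecMul_le_vecMul_discountedResolvent (policyMatrix_mem M.augKernel_mem hp)
    M.γ_mem.1.le M.γ_mem.2 (m := Sum.elim μ fun _ => 0) (by rintro (s | z) <;> simp [hμ])
    (Sum.inl s)
  have h2 : ((Sum.elim μ fun _ => 0) ᵥ* policyMatrix M.augKernel p) (Sum.inl s) = 0 := by
    simp [vecMul, dotProduct, policyMatrix_augKernel_inl]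
  rwa [h2, mul_zero, add_zero] at h

/-- Only the first transition of the chain is counted, so the bound involves the first-stage
probabilities alone. -/
theorem le_discountedVisits_inr (M : RiskMDP S A)
    {p : S ⊕ (S × EtaGrid H) → A × EtaGrid H → ℝ} (hp : ∀ y, p y ∈ stdSimplex ℝ (A × EtaGrid H))
    {μ : S → ℝ} (hμ : ∀ s, 0 ≤ μ s) {l : ℝ} (hl : ∀ s x, l ≤ p (Sum.inl s) x)
    (z : S × EtaGrid H) :
    M.γ * (l * M.muP μ z)
      ≤ discountedVisits M.augKernel M.γ p (Sum.elim μ fun _ => 0) (Sum.inr z) := by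
  have h := add_vecMul_le_vecMul_discountedResolvent (policyMatrix_mem M.augKernel_mem hp)
    M.γ_mem.1.le M.γ_mem.2 (m := Sum.elim μ fun _ => 0) (by rintro (s | z) <;> simp [hμ])
    (Sum.inr z)
  refine le_trans ?_ h
  simp only [vecMul, dotProduct, Fintype.sum_sum_type, Sum.elim_inl, Sum.elim_inr, zero_mul,
    Finset.sum_const_zero, add_zero, zero_add, policyMatrix_augKernel_inr, id, muP,
    Finset.mul_sum]
  refine Finset.sum_le_sum fun s _ => Finset.sum_le_sum fun a _ => ?_
  have h2 := mul_le_mul_of_nonneg_right (hl s (a, z.2))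
    (mul_nonneg (hμ s) ((M.P_mem s a).1 z.1))
  have h3 := mul_le_mul_of_nonneg_left h2 M.γ_mem.1.le
  linarith

omit [DecidableEq S] in
theorem muP_nonneg (M : RiskMDP S A) {μ : S → ℝ} (hμ : ∀ s, 0 ≤ μ s) (z : S × EtaGrid H) :
    0 ≤ M.muP μ z :=
  Finset.sum_nonneg fun s _ => Finset.sum_nonneg fun a _ => mul_nonneg (hμ s) ((M.P_mem s a).1 _)

theorem visit_nonneg (M : RiskMDP S A) (π : RiskPolicy S A H) {ρ : S → ℝ} (hρ : ∀ s, 0 ≤ ρ s)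
    (z : S × EtaGrid H) : 0 ≤ M.visit π ρ z := by
  refine Finset.sum_nonneg fun z₂ _ => mul_nonneg (Finset.sum_nonneg fun s _ => mul_nonneg (hρ s)
    (Finset.sum_nonneg fun a _ => mul_nonneg ((π.one_mem s).1 _) ((M.P_mem s a).1 _))) ?_
  rw [visitFrom_eq]
  exact mul_nonneg (by linarith [M.γ_mem.2]) (discountedResolvent_nonneg (M.transMatrix_mem π)
    M.γ_mem.1.le M.γ_mem.2 _ _)

theorem ratioNorm_nonneg {Y : Type*} (f g : Y → ℝ) : 0 ≤ ratioNorm f g :=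
  Real.iSup_nonneg fun _ => abs_nonneg _

theorem le_ratioNorm_mul {Y : Type*} [Finite Y] {f g : Y → ℝ} (hg : ∀ y, 0 ≤ g y)
    (hfg : ∀ y, g y = 0 → f y = 0) (y : Y) : f y ≤ ratioNorm f g * g y := by
  rcases (hg y).eq_or_lt with h | h
  · rw [hfg y h.symm, ← h, mul_zero]
  · rw [← div_le_iff₀ h]
    exact (le_abs_self _).trans (le_ciSup (f := fun y => |f y / g y|) (Set.finite_range _).bddAbove y)

theorem sum_unifDist (Y : Type*) [Fintype Y] [Nonempty Y] : ∑ y, unifDist Y y = 1 := by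
  simp [unifDist]

theorem unifDist_nonneg {Y : Type*} [Fintype Y] (y : Y) : 0 ≤ unifDist Y y := by
  unfold unifDist
  positivity

/-- Gradient domination: if no action has a large weighted advantage, the policy is almost
optimal. -/
theorem J_sub_J_le [Nonempty S] (M : RiskMDP S A) (π πs : RiskPolicy S A H) {μ ρ : S → ℝ}
    (hμ : ∀ s, 0 ≤ μ s) (hρ : ∀ s, 0 ≤ ρ s) (hρμ : ∀ s, μ s = 0 → ρ s = 0)
    (hdμ : ∀ z : S × EtaGrid H, M.muP μ z = 0 → M.visit πs ρ z = 0) {κ l : ℝ} (hκ : 0 ≤ κ)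
    (hl0 : 0 < l) (hl : ∀ s x, l ≤ π.one s x)
    (hadv : ∀ y x, -(κ * augWeight S H y) ≤
      discountedVisits M.augKernel M.γ (augPolicy π) (Sum.elim μ fun _ => 0) y *
        (policyQ M.augCost M.augKernel M.γ (augPolicy π) y x
          - policyValue M.augCost M.augKernel M.γ (augPolicy π) y)) :
    M.J π ρ - M.J πs ρ ≤ κ * (ratioNorm ρ μ
      + 1 / ((1 - M.γ) * l) * ratioNorm (M.visit πs ρ) (M.muP μ)) := by
  have hγ : 0 < 1 - M.γ := by linarith [M.γ_mem.2]
  have hγ0 := M.γ_mem.1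
  rw [J_eq, J_eq, sum_mul_policyValue_sub M.augKernel_mem M.γ_mem.1.le
    M.γ_mem.2 (augPolicy_mem πs), discountedVisits_aug, Fintype.sum_sum_type, mul_add]
  set d := discountedVisits M.augKernel M.γ (augPolicy π) (Sum.elim μ fun _ => 0)
  set V := policyValue M.augCost M.augKernel M.γ (augPolicy π)
  set Q := policyQ M.augCost M.augKernel M.γ (augPolicy π)
  have hw : ∀ y, 0 ≤ κ * augWeight S H y := by
    rintro (s | z)
    · exact mul_nonneg hκ (unifDist_nonneg s)
    · exact mul_nonneg hκ (unifDist_nonneg z)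
  -- A positive `V - Q` only loses when `d y` is replaced by a smaller weight; a negative one is
  -- harmless because the bound is nonnegative.
  have key : ∀ (y x) (e : ℝ), 0 ≤ e → e ≤ d y → e * (V y - Q y x) ≤ κ * augWeight S H y := by
    intro y x e he hed
    rcases le_total (V y - Q y x) 0 with h | h
    · exact (mul_nonpos_of_nonneg_of_nonpos he h).trans (hw y)
    · have h1 := mul_le_mul_of_nonneg_right hed h
      linarith [hadv y x]
  have hmean : ∀ (y) (e : ℝ), 0 ≤ e → e ≤ d y →
      e * ∑ x, augPolicy πs y x * (V y - Q y x) ≤ κ * augWeight S H y := fun y e he hed => by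
    rw [Finset.mul_sum]
    simp only [mul_left_comm e]
    exact sum_mul_le_of_mem_stdSimplex (augPolicy_mem πs y) fun x => key y x e he hed
  have hext : ∀ f g a b r : ℝ, 0 ≤ f → 0 ≤ g → 0 ≤ r → 0 ≤ b → f ≤ r * g → g * a ≤ b →
      f * a ≤ r * b := fun f g a b r hf hg hr hb hfg hab => by
    rcases le_total a 0 with h | h
    · exact (mul_nonpos_of_nonneg_of_nonpos hf h).trans (mul_nonneg hr hb)
    · calc f * a ≤ r * g * a := mul_le_mul_of_nonneg_right hfg h
        _ = r * (g * a) := by ring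
        _ ≤ r * b := mul_le_mul_of_nonneg_left hab hr
  refine add_le_add ?_ ?_
  · calc ∑ s, Sum.elim ρ (fun z => M.γ / (1 - M.γ) * M.visit πs ρ z) (Sum.inl s) *
          ∑ x, augPolicy πs (Sum.inl s) x * (V (Sum.inl s) - Q (Sum.inl s) x)
        ≤ ∑ s, ratioNorm ρ μ * (κ * unifDist S s) := by
          refine Finset.sum_le_sum fun s _ => hext _ (μ s) _ _ _ (hρ s) (hμ s)
            (ratioNorm_nonneg _ _) (hw (Sum.inl s)) (le_ratioNorm_mul hμ hρμ s)
            (hmean (Sum.inl s) (μ s) (hμ s) (M.le_discountedVisits_inl (augPolicy_mem π) hμ s))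
      _ = κ * ratioNorm ρ μ := by
          rw [← Finset.mul_sum, ← Finset.mul_sum, sum_unifDist]
          ring
  · calc ∑ z, Sum.elim ρ (fun z => M.γ / (1 - M.γ) * M.visit πs ρ z) (Sum.inr z) *
          ∑ x, augPolicy πs (Sum.inr z) x * (V (Sum.inr z) - Q (Sum.inr z) x)
        ≤ ∑ z, 1 / ((1 - M.γ) * l) * ratioNorm (M.visit πs ρ) (M.muP μ)
            * (κ * unifDist (S × EtaGrid H) z) := by
          refine Finset.sum_le_sum fun z _ => hext _ (M.γ * (l * M.muP μ z)) _ _ _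
            (mul_nonneg (div_nonneg hγ0.le hγ.le) (M.visit_nonneg πs hρ z))
            (mul_nonneg hγ0.le (mul_nonneg hl0.le (M.muP_nonneg hμ z)))
            (mul_nonneg (by positivity) (ratioNorm_nonneg _ _)) (hw (Sum.inr z)) ?_
            (hmean (Sum.inr z) _ (mul_nonneg hγ0.le (mul_nonneg hl0.le (M.muP_nonneg hμ z)))
              (M.le_discountedVisits_inr (augPolicy_mem π) hμ hl z))
          -- The factor `γ` of the optimal visits cancels against that of the lower bound `γ l μ^P`,
          -- which leaves `1 / ((1 - γ) l)`.
          have h1 := mul_le_mul_of_nonneg_left (le_ratioNorm_mul (M.muP_nonneg hμ) hdμ z)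
            (div_nonneg hγ0.le hγ.le)
          refine h1.trans_eq ?_
          field_simp
      _ = κ * (1 / ((1 - M.γ) * l) * ratioNorm (M.visit πs ρ) (M.muP μ)) := by
          rw [← Finset.mul_sum, ← Finset.mul_sum, sum_unifDist]
          ring

omit [DecidableEq S] [Fintype A] in
-- Makes `cbarNorm` a bound for the costs of both stages, and shows that it is at least 1.
theorem one_le_cbarNorm (M : RiskMDP S A) : 1 + M.γ * M.lam ≤ M.cbarNorm := by
  have h : M.lam ≤ M.lam / M.α := by
    rw [le_div_iff₀ M.α_mem.1]
    nlinarith [M.lam_mem.1, M.α_mem.2]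
  rw [cbarNorm]
  linarith

theorem etaVal_mem (h : EtaGrid H) : etaVal h ∈ Set.Icc (0 : ℝ) 1 := by
  refine ⟨by unfold etaVal; positivity, div_le_one_of_le₀ ?_ (by positivity)⟩
  exact_mod_cast Nat.lt_succ_iff.1 h.2

omit [DecidableEq S] [Fintype A] in
theorem augCost_mem (M : RiskMDP S A) (y : S ⊕ (S × EtaGrid H)) (x : A × EtaGrid H) :
    augCost M y x ∈ Set.Icc 0 M.cbarNorm := by
  have hγ := M.γ_mem
  have hl := M.lam_mem
  have hη := etaVal_mem x.2
  have h1 : 0 ≤ M.γ * M.lam := mul_nonneg hγ.1.le hl.1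
  have h2 := mul_nonneg h1 hη.1
  have h3 : M.γ * M.lam * etaVal x.2 ≤ M.γ * M.lam := mul_le_of_le_one_right h1 hη.2
  rcases y with s | z
  · have hc := M.cost_mem s x.1
    have := M.one_le_cbarNorm
    simp only [augCost, Sum.elim_inl, Set.mem_Icc] at *
    constructor <;> linarith
  · have hc := M.cost_mem z.1 x.1
    have h4 : 0 ≤ M.lam / M.α := div_nonneg hl.1 M.α_mem.1.le
    have h5 : max (M.cost z.1 x.1 - etaVal z.2) 0 ≤ 1 :=
      max_le (by linarith [hc.2, (etaVal_mem z.2).1]) zero_le_one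
    have h6 := mul_le_of_le_one_right h4 h5
    have h7 := mul_nonneg h4 (le_max_right (M.cost z.1 x.1 - etaVal z.2) 0)
    have h8 : (1 - M.lam) * M.cost z.1 x.1 ≤ 1 - M.lam :=
      mul_le_of_le_one_right (by linarith [hl.2]) hc.2
    have h9 : 0 ≤ (1 - M.lam) * M.cost z.1 x.1 := mul_nonneg (by linarith [hl.2]) hc.1
    simp only [augCost, Sum.elim_inr, Set.mem_Icc, laterCost, cbarNorm]
    constructor <;> linarith

end RiskMDP

/-! ### The regularized objective along gradient descent, and its constants. -/

namespace RiskMDP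

variable {S A : Type*} [Fintype S] [DecidableEq S] [Nonempty S] [Fintype A] [Nonempty A] {H : ℕ}

omit [Fintype S] [DecidableEq S] [Nonempty S] in
theorem augPolicy_softmaxPolicy (θ : RiskParam S A H) :
    augPolicy (softmaxPolicy θ) = tabularSoftmax (augParam θ) := by
  funext y
  rcases y with s | z <;> rfl

omit [Nonempty S] in
theorem L_eq_barrierObjective (M : RiskMDP S A) (μ : S → ℝ) (κ : ℝ) (θ : RiskParam S A H) :
    M.L μ κ θ = barrierObjective M.augCost M.augKernel M.γ (Sum.elim μ fun _ => 0)
      (augWeight S H) κ (augParam θ) := by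
  rw [L, barrierObjective, J_eq, augPolicy_softmaxPolicy,
    Fintype.sum_sum_type fun y => augWeight S H y * finKL _ (tabularSoftmax (augParam θ) y),
    mul_add, add_assoc]
  rfl

/-- The gradient of `L_κ`. -/
noncomputable def gradL (M : RiskMDP S A) (μ : S → ℝ) (κ : ℝ) (θ : RiskParam S A H) :
    RiskParam S A H :=
  WithLp.toLp 2 <| Sum.elim
    (fun i => barrierGradient M.augCost M.augKernel M.γ (Sum.elim μ fun _ => 0)
      (augWeight S H) κ (augParam θ) (Sum.inl i.1) i.2)
    fun i => barrierGradient M.augCost M.augKernel M.γ (Sum.elim μ fun _ => 0)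
      (augWeight S H) κ (augParam θ) (Sum.inr i.1) i.2

omit [DecidableEq S] [Nonempty S] [Nonempty A] in
theorem sum_augParam_sq (θ : RiskParam S A H) :
    ∑ y, ∑ x, augParam θ y x ^ 2 = ‖θ‖ ^ 2 := by
  rw [EuclideanSpace.norm_sq_eq]
  simp [Fintype.sum_sum_type, augParam, Fintype.sum_prod_type]

omit [Nonempty S] [Nonempty A] in
theorem inner_gradL (M : RiskMDP S A) (μ : S → ℝ) (κ : ℝ) (θ δ : RiskParam S A H) :
    inner ℝ (M.gradL μ κ θ) δ = ∑ y, ∑ x, barrierGradient M.augCost M.augKernel M.γ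
      (Sum.elim μ fun _ => 0) (augWeight S H) κ (augParam θ) y x * augParam δ y x := by
  simp [PiLp.inner_apply, Fintype.sum_sum_type, augParam, gradL, Fintype.sum_prod_type, mul_comm]

omit [Nonempty S] [Nonempty A] in
theorem abs_barrierGradient_le_norm (M : RiskMDP S A) (μ : S → ℝ) (κ : ℝ) (θ : RiskParam S A H)
    (y : S ⊕ (S × EtaGrid H)) (x : A × EtaGrid H) :
    |barrierGradient M.augCost M.augKernel M.γ (Sum.elim μ fun _ => 0) (augWeight S H) κ
      (augParam θ) y x| ≤ ‖M.gradL μ κ θ‖ := by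
  rcases y with s | z
  · exact PiLp.norm_apply_le (M.gradL μ κ θ) (Sum.inl (s, x))
  · exact PiLp.norm_apply_le (M.gradL μ κ θ) (Sum.inr (z, x))

omit [DecidableEq S] [Nonempty S] in
theorem augWeight_nonneg (y : S ⊕ (S × EtaGrid H)) : 0 ≤ augWeight S H y := by
  rcases y with s | z
  · exact unifDist_nonneg s
  · exact unifDist_nonneg z

omit [DecidableEq S] in
theorem augWeight_pos (y : S ⊕ (S × EtaGrid H)) : 0 < augWeight S H y := by
  rcases y with s | z <;> simp only [augWeight, Sum.elim_inl, Sum.elim_inr, unifDist] <;>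
    exact one_div_pos.2 (by exact_mod_cast Fintype.card_pos)

omit [DecidableEq S] in
theorem sum_augWeight : ∑ y, augWeight S H y = 2 := by
  simp only [augWeight, Fintype.sum_sum_type, Sum.elim_inl, Sum.elim_inr, sum_unifDist]
  norm_num

omit [DecidableEq S] [Nonempty S] in
theorem sumElim_zero_mem {μ : S → ℝ} (hμ : μ ∈ stdSimplex ℝ S) :
    (Sum.elim μ fun _ => 0) ∈ stdSimplex ℝ (S ⊕ (S × EtaGrid H)) := by
  constructor
  · rintro (s | z)
    · exact hμ.1 s
    · exact le_rfl
  · simp [Fintype.sum_sum_type, hμ.2]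

omit [DecidableEq S] [Fintype A] [Nonempty A] in
theorem sigma_pos (M : RiskMDP S A) {κ : ℝ} (hκ : 0 ≤ κ) : 0 < M.sigma H κ := by
  have hγ : 0 < 1 - M.γ := by linarith [M.γ_mem.2]
  have h1 : 0 ≤ M.lam / M.α := div_nonneg M.lam_mem.1 M.α_mem.1.le
  have h2 : 0 < M.cbarNorm := by
    linarith [M.one_le_cbarNorm, mul_nonneg M.γ_mem.1.le M.lam_mem.1]
  have h3 := M.lam_mem.1
  unfold sigma
  positivity

/-- The barrier weights sum to 2, so the remainder coefficient is `2 K / (1 - γ)³ + 2 κ` with `K =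
cbarNorm`. Since `κ ≤ 1 ≤ K / (1 - γ)³`, it is at most `4 K / (1 - γ)³`, which is part of `σ / 2`.
-/
theorem abs_L_add_sub_sub_le (M : RiskMDP S A) {μ : S → ℝ} (hμ : μ ∈ stdSimplex ℝ S) {κ : ℝ}
    (hκ : 0 ≤ κ) (hκ_le : κ ≤ 1) (θ δ : RiskParam S A H) :
    |M.L μ κ (θ + δ) - M.L μ κ θ - inner ℝ (M.gradL μ κ θ) δ| ≤ M.sigma H κ / 2 * ‖δ‖ ^ 2 := by
  have hγ : 0 < 1 - M.γ := by linarith [M.γ_mem.2]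
  have hK : 1 ≤ M.cbarNorm := by
    linarith [M.one_le_cbarNorm, mul_nonneg M.γ_mem.1.le M.lam_mem.1]
  have h1 : 0 ≤ M.lam / M.α := div_nonneg M.lam_mem.1 M.α_mem.1.le
  have h := abs_barrierObjective_sub_sub_le (θ := augParam θ) (θ' := augParam (θ + δ))
    (δ := augParam δ) (b := ‖δ‖) M.augKernel_mem M.γ_mem.1.le M.γ_mem.2
    (fun y x => (M.augCost_mem y x).1) (fun y x => (M.augCost_mem y x).2) (by linarith)
    (sumElim_zero_mem hμ) (augWeight_nonneg (S := S) (H := H)) sum_augWeight hκ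
    (by rintro (s | z) x <;> rfl) (norm_nonneg _) fun y => by
      rw [← sum_augParam_sq]
      exact Finset.single_le_sum (f := fun y => ∑ x, augParam δ y x ^ 2)
        (fun y _ => Finset.sum_nonneg fun x _ => sq_nonneg _) (Finset.mem_univ y)
  rw [L_eq_barrierObjective, L_eq_barrierObjective, inner_gradL]
  refine h.trans (mul_le_mul_of_nonneg_right ?_ (sq_nonneg _))
  have h2 : 1 ≤ M.cbarNorm / (1 - M.γ) ^ 3 := by
    rw [one_le_div (by positivity)]
    exact (pow_le_one₀ hγ.le (by linarith [M.γ_mem.1])).trans hK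
  have h3 : 0 ≤ 2 * κ / (Fintype.card S : ℝ) := by positivity
  have h4 : 0 ≤ 2 * κ / ((Fintype.card S : ℝ) * (Fintype.card (EtaGrid H) : ℝ)) := by positivity
  have h5 : 2 * M.cbarNorm / (1 - M.γ) ^ 3 = 2 * (M.cbarNorm / (1 - M.γ) ^ 3) := by ring
  have h6 : 8 / (1 - M.γ) ^ 3 * M.cbarNorm = 8 * (M.cbarNorm / (1 - M.γ) ^ 3) := by ring
  have h7 := M.lam_mem.1
  rw [sigma, h5, h6]
  linarith

theorem gradient_L (M : RiskMDP S A) {μ : S → ℝ} (hμ : μ ∈ stdSimplex ℝ S) {κ : ℝ}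
    (hκ : 0 ≤ κ) (hκ_le : κ ≤ 1) (θ : RiskParam S A H) :
    gradient (M.L μ κ) θ = M.gradL μ κ θ :=
  (hasGradientAt_of_quadratic_bound (M.abs_L_add_sub_sub_le hμ hκ hκ_le θ)).gradient

theorem L_iter_succ_le (M : RiskMDP S A) {μ : S → ℝ} (hμ : μ ∈ stdSimplex ℝ S) {κ : ℝ}
    (hκ : 0 ≤ κ) (hκ_le : κ ≤ 1) (θ₀ : RiskParam S A H) (t : ℕ) :
    M.L μ κ (M.iter μ κ θ₀ (t + 1)) ≤ M.L μ κ (M.iter μ κ θ₀ t)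
      - 1 / (2 * M.sigma H κ) * ‖M.gradL μ κ (M.iter μ κ θ₀ t)‖ ^ 2 := by
  rw [iter, gradient_L M hμ hκ hκ_le]
  exact descent_of_quadratic_bound (M.sigma_pos hκ) (M.abs_L_add_sub_sub_le hμ hκ hκ_le _)

theorem L_iter_le (M : RiskMDP S A) {μ : S → ℝ} (hμ : μ ∈ stdSimplex ℝ S) {κ : ℝ}
    (hκ : 0 ≤ κ) (hκ_le : κ ≤ 1) (θ₀ : RiskParam S A H) (t : ℕ) :
    M.L μ κ (M.iter μ κ θ₀ t) ≤ M.L μ κ θ₀ := by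
  induction t with
  | zero => exact le_rfl
  | succ t ih =>
    have h1 := M.L_iter_succ_le hμ hκ hκ_le θ₀ t
    have h2 := M.sigma_pos (H := H) hκ
    have h3 : 0 ≤ 1 / (2 * M.sigma H κ) * ‖M.gradL μ κ (M.iter μ κ θ₀ t)‖ ^ 2 := by positivity
    linarith

omit [Fintype S] [DecidableEq S] [Nonempty S] in
theorem finKL_augPolicy_nonneg (θ : RiskParam S A H) (y : S ⊕ (S × EtaGrid H)) :
    0 ≤ finKL (unifDist (A × EtaGrid H)) (tabularSoftmax (augParam θ) y) :=
  finKL_unifDist_nonneg (tabularSoftmax_mem _ _) (softmaxFun_pos _)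

omit [Nonempty S] in
theorem sum_policyValue_mem (M : RiskMDP S A) {μ : S → ℝ} (hμ : μ ∈ stdSimplex ℝ S)
    (θ : RiskParam S A H) :
    ∑ y, Sum.elim μ (fun _ => 0) y *
        policyValue M.augCost M.augKernel M.γ (tabularSoftmax (augParam θ)) y
      ∈ Set.Icc 0 (M.cbarNorm / (1 - M.γ)) :=
  ⟨sum_mul_nonneg_of_mem_stdSimplex (sumElim_zero_mem hμ) (policyValue_nonneg M.augKernel_mem
      (tabularSoftmax_mem _) M.γ_mem.1.le M.γ_mem.2 fun y x => (M.augCost_mem y x).1),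
    sum_mul_le_of_mem_stdSimplex (sumElim_zero_mem hμ) (policyValue_le M.augKernel_mem
      (tabularSoftmax_mem _) M.γ_mem.1.le M.γ_mem.2 fun y x => (M.augCost_mem y x).2)⟩

omit [Nonempty S] in
theorem mul_finKL_le_L (M : RiskMDP S A) {μ : S → ℝ} (hμ : μ ∈ stdSimplex ℝ S) {κ : ℝ}
    (hκ : 0 ≤ κ) (θ : RiskParam S A H) (y : S ⊕ (S × EtaGrid H)) :
    κ * (augWeight S H y * finKL (unifDist (A × EtaGrid H)) (tabularSoftmax (augParam θ) y))
      ≤ M.L μ κ θ := by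
  rw [L_eq_barrierObjective, barrierObjective]
  have h1 := (M.sum_policyValue_mem hμ θ).1
  have h2 := mul_le_mul_of_nonneg_left (Finset.single_le_sum (f := fun y => augWeight S H y *
    finKL (unifDist (A × EtaGrid H)) (tabularSoftmax (augParam θ) y))
    (fun y _ => mul_nonneg (augWeight_nonneg y) (finKL_augPolicy_nonneg θ y))
    (Finset.mem_univ y)) hκ
  linarith

theorem L_nonneg (M : RiskMDP S A) {μ : S → ℝ} (hμ : μ ∈ stdSimplex ℝ S) {κ : ℝ}
    (hκ : 0 ≤ κ) (θ : RiskParam S A H) : 0 ≤ M.L μ κ θ :=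
  (mul_nonneg hκ (mul_nonneg (augWeight_nonneg _) (finKL_augPolicy_nonneg θ _))).trans
    (M.mul_finKL_le_L hμ hκ θ (Sum.inl (Classical.arbitrary S)))

/-- The barrier keeps the action probabilities along the iteration away from zero. -/
theorem exists_pos_le_iterPolicy (M : RiskMDP S A) {μ : S → ℝ} (hμ : μ ∈ stdSimplex ℝ S) {κ : ℝ}
    (hκ : 0 < κ) (hκ_le : κ ≤ 1) (θ₀ : RiskParam S A H) :
    ∃ l, 0 < l ∧ ∀ t y x, l ≤ augPolicy (M.iterPolicy μ κ θ₀ t) y x := by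
  -- The smallest barrier weight makes the lower bound uniform in the state; monotonicity of `L`
  -- makes it uniform in `t`.
  obtain ⟨y₀, hy₀⟩ := Finite.exists_min (augWeight S H)
  refine ⟨_, Real.exp_pos (-(Fintype.card (A × EtaGrid H) * (M.L μ κ θ₀ / (κ * augWeight S H y₀)
    + Real.log (Fintype.card (A × EtaGrid H))))), fun t y x => ?_⟩
  rw [iterPolicy, augPolicy_softmaxPolicy]
  refine exp_le_of_finKL_unifDist_le (tabularSoftmax_mem _ y) (softmaxFun_pos _) ?_ x
  have hw : 0 < κ * augWeight S H y₀ := mul_pos hκ (augWeight_pos y₀)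
  rw [le_div_iff₀ hw]
  have h1 := (M.mul_finKL_le_L hμ hκ.le (M.iter μ κ θ₀ t) y).trans
    (M.L_iter_le hμ hκ.le hκ_le θ₀ t)
  have h2 := mul_le_mul_of_nonneg_right (hy₀ y)
    (finKL_augPolicy_nonneg (M.iter μ κ θ₀ t) y)
  have h3 := mul_le_mul_of_nonneg_left h2 hκ.le
  linarith

theorem le_piLB₁ (M : RiskMDP S A) {μ : S → ℝ} {κ l : ℝ} {θ₀ : RiskParam S A H}
    (h : ∀ t y x, l ≤ augPolicy (M.iterPolicy μ κ θ₀ t) y x) : l ≤ M.piLB₁ μ κ θ₀ :=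
  le_ciInf fun t => le_ciInf fun s => le_ciInf fun x => h (t + 1) (Sum.inl s) x

theorem le_piLB₂ (M : RiskMDP S A) {μ : S → ℝ} {κ l : ℝ} {θ₀ : RiskParam S A H}
    (h : ∀ t y x, l ≤ augPolicy (M.iterPolicy μ κ θ₀ t) y x) : l ≤ M.piLB₂ μ κ θ₀ :=
  le_ciInf fun t => le_ciInf fun z => le_ciInf fun x => h (t + 1) (Sum.inr z) x

theorem iInf_iInf_iInf_le {Y X : Type*} {f : ℕ → Y → X → ℝ} (h : ∀ t y x, 0 ≤ f t y x)
    (t : ℕ) (y : Y) (x : X) : ⨅ t, ⨅ y, ⨅ x, f t y x ≤ f t y x :=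
  (ciInf_le ⟨0, by
      rintro _ ⟨t, rfl⟩
      exact Real.iInf_nonneg fun y => Real.iInf_nonneg fun x => h t y x⟩ t).trans
    ((ciInf_le ⟨0, by
      rintro _ ⟨y, rfl⟩
      exact Real.iInf_nonneg fun x => h t y x⟩ y).trans
    (ciInf_le ⟨0, by
      rintro _ ⟨x, rfl⟩
      exact h t y x⟩ x))

omit [Nonempty S] in
theorem piLB₁_le (M : RiskMDP S A) (μ : S → ℝ) (κ : ℝ) (θ₀ : RiskParam S A H) {t : ℕ}
    (ht : 1 ≤ t) (s : S) (x : A × EtaGrid H) :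
    M.piLB₁ μ κ θ₀ ≤ (M.iterPolicy μ κ θ₀ t).one s x := by
  obtain ⟨t, rfl⟩ := Nat.exists_eq_add_of_le' ht
  exact iInf_iInf_iInf_le (f := fun t => (M.iterPolicy μ κ θ₀ (t + 1)).one)
    (fun t s x => ((M.iterPolicy μ κ θ₀ (t + 1)).one_mem s).1 x) t s x

omit [Nonempty S] in
theorem piLB₂_le (M : RiskMDP S A) (μ : S → ℝ) (κ : ℝ) (θ₀ : RiskParam S A H) {t : ℕ}
    (ht : 1 ≤ t) (z : S × EtaGrid H) (x : A × EtaGrid H) :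
    M.piLB₂ μ κ θ₀ ≤ (M.iterPolicy μ κ θ₀ t).two z x := by
  obtain ⟨t, rfl⟩ := Nat.exists_eq_add_of_le' ht
  exact iInf_iInf_iInf_le (f := fun t => (M.iterPolicy μ κ θ₀ (t + 1)).two)
    (fun t z x => ((M.iterPolicy μ κ θ₀ (t + 1)).two_mem z).1 x) t z x

theorem le_one_of_mem_stdSimplex {Y : Type*} [Fintype Y] {f : Y → ℝ} (hf : f ∈ stdSimplex ℝ Y)
    (y : Y) : f y ≤ 1 := by
  rw [← hf.2]
  exact Finset.single_le_sum (fun y _ => hf.1 y) (Finset.mem_univ y)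

theorem piLB₁_le_one (M : RiskMDP S A) (μ : S → ℝ) (κ : ℝ) (θ₀ : RiskParam S A H) :
    M.piLB₁ μ κ θ₀ ≤ 1 :=
  (M.piLB₁_le μ κ θ₀ le_rfl (Classical.arbitrary S) (Classical.arbitrary _)).trans
    (le_one_of_mem_stdSimplex ((M.iterPolicy μ κ θ₀ 1).one_mem _) _)

theorem piLB₂_le_one (M : RiskMDP S A) (μ : S → ℝ) (κ : ℝ) (θ₀ : RiskParam S A H) :
    M.piLB₂ μ κ θ₀ ≤ 1 :=
  (M.piLB₂_le μ κ θ₀ le_rfl (Classical.arbitrary _) (Classical.arbitrary _)).trans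
    (le_one_of_mem_stdSimplex ((M.iterPolicy μ κ θ₀ 1).two_mem _) _)

omit [DecidableEq S] [Nonempty S] [Fintype A] [Nonempty A] in
theorem cbarNorm_div_le_Cbar (M : RiskMDP S A) : M.cbarNorm / (1 - M.γ) ≤ M.Cbar := by
  have h1 : 0 ≤ M.lam / M.α := div_nonneg M.lam_mem.1 M.α_mem.1.le
  have h2 := M.lam_mem.1
  rw [Cbar, one_div_mul_eq_div]
  linarith

theorem Bbar_pos (M : RiskMDP S A) {μ : S → ℝ} {κ : ℝ} {θ₀ : RiskParam S A H}
    (h1 : 0 < M.piLB₁ μ κ θ₀) (h2 : 0 < M.piLB₂ μ κ θ₀) : 0 < M.Bbar μ κ θ₀ := by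
  have hK : 1 ≤ M.cbarNorm := by
    linarith [M.one_le_cbarNorm, mul_nonneg M.γ_mem.1.le M.lam_mem.1]
  have h3 : 0 < M.cbarNorm / (1 - M.γ) := div_pos (by linarith) (by linarith [M.γ_mem.2])
  have h4 := Real.log_nonpos h1.le (M.piLB₁_le_one μ κ θ₀)
  have h5 := Real.log_nonpos h2.le (M.piLB₂_le_one μ κ θ₀)
  rw [Bbar]
  linarith [M.cbarNorm_div_le_Cbar]

/-- Iterate 1 is the earliest one covered by the infima `piLB₁` and `piLB₂`. They bound the two
average KL terms, and `κ ≤ 1` removes the prefactors. -/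
theorem L_iter_one_le_Bbar (M : RiskMDP S A) {μ : S → ℝ} (hμ : μ ∈ stdSimplex ℝ S) {κ : ℝ}
    (hκ_le : κ ≤ 1) (hκ : 0 ≤ κ) {θ₀ : RiskParam S A H}
    (h1 : 0 < M.piLB₁ μ κ θ₀) (h2 : 0 < M.piLB₂ μ κ θ₀) :
    M.L μ κ (M.iter μ κ θ₀ 1) ≤ M.Bbar μ κ θ₀ := by
  have h4 := Real.log_nonpos h1.le (M.piLB₁_le_one μ κ θ₀)
  have h5 := Real.log_nonpos h2.le (M.piLB₂_le_one μ κ θ₀)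
  have hJ := (M.sum_policyValue_mem hμ (M.iter μ κ θ₀ 1)).2
  rw [← augPolicy_softmaxPolicy, ← J_eq] at hJ
  have hone : ∑ s, unifDist S s * finKL (unifDist (A × EtaGrid H))
      ((softmaxPolicy (M.iter μ κ θ₀ 1)).one s) ≤ -Real.log (M.piLB₁ μ κ θ₀) :=
    sum_mul_le_of_mem_stdSimplex ⟨unifDist_nonneg, sum_unifDist S⟩ fun s =>
      finKL_unifDist_le h1 fun x => M.piLB₁_le μ κ θ₀ le_rfl s x
  have htwo : ∑ z, unifDist (S × EtaGrid H) z * finKL (unifDist (A × EtaGrid H))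
      ((softmaxPolicy (M.iter μ κ θ₀ 1)).two z) ≤ -Real.log (M.piLB₂ μ κ θ₀) :=
    sum_mul_le_of_mem_stdSimplex ⟨unifDist_nonneg, sum_unifDist _⟩ fun z =>
      finKL_unifDist_le h2 fun x => M.piLB₂_le μ κ θ₀ le_rfl z x
  have h6 := (mul_le_mul_of_nonneg_left hone hκ).trans (mul_le_of_le_one_left (by linarith) hκ_le)
  have h7 := (mul_le_mul_of_nonneg_left htwo hκ).trans (mul_le_of_le_one_left (by linarith) hκ_le)
  rw [L, Bbar]
  linarith [M.cbarNorm_div_le_Cbar]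

omit [DecidableEq S] [Fintype A] [Nonempty A] in
theorem sigma_le (M : RiskMDP S A) {κ : ℝ} (hκ_le : κ ≤ 1) :
    M.sigma H κ ≤ 2 * (3 * (M.lam / M.α + M.lam) + 4 * M.cbarNorm + 2) / (1 - M.γ) ^ 3 := by
  have hγ : 0 < 1 - M.γ := by linarith [M.γ_mem.2]
  have h1 : 0 ≤ M.lam / M.α := div_nonneg M.lam_mem.1 M.α_mem.1.le
  have h2 := M.lam_mem.1
  have hS : (1 : ℝ) ≤ Fintype.card S := by exact_mod_cast Fintype.card_pos
  have hE : (1 : ℝ) ≤ Fintype.card (EtaGrid H) := by exact_mod_cast Fintype.card_pos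
  have h3 : 2 * κ / (Fintype.card S : ℝ) ≤ 2 := by
    rw [div_le_iff₀ (by linarith)]
    linarith
  have h4 : 2 * κ / ((Fintype.card S : ℝ) * (Fintype.card (EtaGrid H) : ℝ)) ≤ 2 := by
    rw [div_le_iff₀ (by positivity)]
    nlinarith [one_le_mul_of_one_le_of_one_le hS hE]
  have h5 : (6 * (M.lam / M.α + M.lam) + 4) * (1 - M.γ) ^ 3 ≤ 6 * (M.lam / M.α + M.lam) + 4 :=
    mul_le_of_le_one_right (by positivity) (pow_le_one₀ hγ.le (by linarith [M.γ_mem.1]))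
  rw [← le_div_iff₀ (by positivity)] at h5
  have h6 : 2 * (3 * (M.lam / M.α + M.lam) + 4 * M.cbarNorm + 2) / (1 - M.γ) ^ 3
      = (6 * (M.lam / M.α + M.lam) + 4) / (1 - M.γ) ^ 3 + 8 / (1 - M.γ) ^ 3 * M.cbarNorm := by
    ring
  rw [sigma, h6]
  linarith

omit [DecidableEq S] [Nonempty S] in
theorem ratioNorm_pos {ρ μ : S → ℝ} (hρ : ρ ∈ stdSimplex ℝ S) (hμ : ∀ s, 0 ≤ μ s)
    (hρμ : ∀ s, μ s = 0 → ρ s = 0) : 0 < ratioNorm ρ μ := by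
  refine (ratioNorm_nonneg ρ μ).lt_of_ne fun h => ?_
  have h1 : ∑ s, ρ s ≤ 0 := Finset.sum_nonpos fun s _ => by
    simpa [← h] using le_ratioNorm_mul hμ hρμ s
  linarith [hρ.2]

end RiskMDP

/-- Averaging the decrease of a descent method. -/
theorem exists_le_of_descent {f g : ℕ → ℝ} {a e : ℝ} (ha : 0 ≤ a)
    (h : ∀ t, f (t + 1) ≤ f t - a * g t) {T : ℕ} (hT : f 1 - f (T + 1) < T * (a * e)) :
    ∃ t ∈ Finset.Icc 1 T, g t ≤ e := by
  -- If every `g t` exceeds `e`, the decreases telescope to a contradiction. For `T = 0` the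
  -- hypothesis `hT` is already absurd.
  by_contra! hc
  have : ∀ n ≤ T, n * (a * e) ≤ f 1 - f (n + 1) := by
    intro n
    induction n with
    | zero => simp
    | succ n ih =>
      intro hn
      have h1 := ih (by omega)
      have h2 := h (n + 1)
      have h3 := mul_le_mul_of_nonneg_left (hc (n + 1) (by simp; omega)).le ha
      push_cast
      linarith
  linarith [this T le_rfl]

theorem theorem5 {S A : Type*} [Fintype S] [DecidableEq S] [Nonempty S] [Fintype A] [Nonempty A]
    {H : ℕ} (hH : 1 ≤ H) (M : RiskMDP S A)
    (μ : S → ℝ) (hμ : μ ∈ stdSimplex ℝ S)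
    (θ₀ : RiskParam S A H)
    (ρ : S → ℝ) (hρ : ρ ∈ stdSimplex ℝ S)
    (πs : RiskPolicy S A H) (hπs : M.IsOptimal πs ρ)
    (hρμ : ∀ s, μ s = 0 → ρ s = 0)
    (hdμ : ∀ z : S × EtaGrid H, M.muP μ z = 0 → M.visit πs ρ z = 0)
    (ε κ : ℝ) (hε : 0 < ε) (hκ : κ = ε / (2 * M.D₂ μ ρ πs κ θ₀))
    (hκ_le : κ ≤ 1)
    (T : ℕ)
    (hT : 64 * (3 * (M.lam / M.α + M.lam) + 4 * M.cbarNorm + 2) * M.Bbar μ κ θ₀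
        * (Fintype.card S : ℝ) ^ 2 * (Fintype.card A : ℝ) ^ 2
        * (Fintype.card (EtaGrid H) : ℝ) ^ 4
        / ((1 - M.γ) ^ 3 * ε ^ 2) * (M.D₂ μ ρ πs κ θ₀) ^ 2 ≤ (T : ℝ)) :
    ∃ t ∈ Finset.Icc 1 T, M.J (M.iterPolicy μ κ θ₀ t) ρ - M.Jstar H ρ ≤ ε := by
  have hγ : 0 < 1 - M.γ := by linarith [M.γ_mem.2]
  have hpi : 0 ≤ M.piLB₁ μ κ θ₀ :=
    Real.iInf_nonneg fun t => Real.iInf_nonneg fun s => Real.iInf_nonneg fun x =>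
      ((M.iterPolicy μ κ θ₀ (t + 1)).one_mem s).1 x
  -- Positivity comes from the ratio of `ρ` to `μ` alone: so far `piLB₁` is only known to be
  -- nonnegative, with `1 / 0 = 0`. This gives `0 < κ`, and only then does the barrier give `0 <
  -- piLB₁`.
  have hD : 0 < M.D₂ μ ρ πs κ θ₀ :=
    add_pos_of_pos_of_nonneg (RiskMDP.ratioNorm_pos hρ hμ.1 hρμ)
      (mul_nonneg (by positivity) (RiskMDP.ratioNorm_nonneg _ _))
  have hκ0 : 0 < κ := by rw [hκ]; positivity
  obtain ⟨l, hl0, hl⟩ := M.exists_pos_le_iterPolicy hμ hκ0 hκ_le θ₀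
  have h1 : 0 < M.piLB₁ μ κ θ₀ := hl0.trans_le (M.le_piLB₁ hl)
  have h2 : 0 < M.piLB₂ μ κ θ₀ := hl0.trans_le (M.le_piLB₂ hl)
  have hB := M.Bbar_pos h1 h2
  have hσ := M.sigma_pos (H := H) hκ0.le
  have hS : (0 : ℝ) < Fintype.card S := by exact_mod_cast Fintype.card_pos
  have hA : (0 : ℝ) < Fintype.card A := by exact_mod_cast Fintype.card_pos
  have hE : (0 : ℝ) < Fintype.card (EtaGrid H) := by exact_mod_cast Fintype.card_pos
  have hSE : (1 : ℝ) ≤ Fintype.card (EtaGrid H) := by exact_mod_cast Fintype.card_pos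
  have hF : 0 < 3 * (M.lam / M.α + M.lam) + 4 * M.cbarNorm + 2 := by
    have := div_nonneg M.lam_mem.1 M.α_mem.1.le
    have := M.lam_mem.1
    linarith [M.one_le_cbarNorm, mul_nonneg M.γ_mem.1.le M.lam_mem.1]
  have hσ' := M.sigma_le (H := H) hκ_le
  have hB1 := M.L_iter_one_le_Bbar hμ hκ_le hκ0.le h1 h2
  have hBT := M.L_nonneg hμ hκ0.le (M.iter μ κ θ₀ (T + 1))
  -- `κ` times the smallest barrier weight `1 / (|S||H|)`, divided by the number `|A||H|` of
  -- actions: the threshold that serves every coordinate.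
  set e : ℝ := κ / (Fintype.card S * Fintype.card (EtaGrid H)
    * (Fintype.card A * Fintype.card (EtaGrid H))) with he
  obtain ⟨t, ht, hgt⟩ := exists_le_of_descent (e := e ^ 2) (T := T)
    (f := fun t => M.L μ κ (M.iter μ κ θ₀ t))
    (g := fun t => ‖M.gradL μ κ (M.iter μ κ θ₀ t)‖ ^ 2) (a := 1 / (2 * M.sigma H κ))
    (by positivity) (M.L_iter_succ_le hμ hκ0.le hκ_le θ₀) (by
      refine (show _ ≤ M.Bbar μ κ θ₀ by linarith).trans_lt ?_
      set D := M.D₂ μ ρ πs κ θ₀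
      set F := 3 * (M.lam / M.α + M.lam) + 4 * M.cbarNorm + 2
      have h3 := mul_le_mul_of_nonneg_right hT (sq_nonneg e)
      -- Substituting `κ = ε / (2 D)` gives `T e² ≥ 16 F B̄ / (1 - γ)³`, while descent needs more
      -- than `2 σ B̄`, which is at most `4 F B̄ / (1 - γ)³`.
      have h4 : 64 * F * M.Bbar μ κ θ₀ * (Fintype.card S : ℝ) ^ 2 * (Fintype.card A : ℝ) ^ 2
          * (Fintype.card (EtaGrid H) : ℝ) ^ 4 / ((1 - M.γ) ^ 3 * ε ^ 2) * D ^ 2 * e ^ 2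
          = 16 * F * M.Bbar μ κ θ₀ / (1 - M.γ) ^ 3 := by
        have hκ' : κ = ε / (2 * D) := hκ
        rw [he, hκ']
        field_simp
        ring
      rw [h4] at h3
      have h5 := mul_le_mul_of_nonneg_right hσ' hB.le
      have h6 : 0 < F * M.Bbar μ κ θ₀ / (1 - M.γ) ^ 3 := by positivity
      have h7 : 16 * F * M.Bbar μ κ θ₀ / (1 - M.γ) ^ 3
          = 16 * (F * M.Bbar μ κ θ₀ / (1 - M.γ) ^ 3) := by ring
      have h8 : 2 * F / (1 - M.γ) ^ 3 * M.Bbar μ κ θ₀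
          = 2 * (F * M.Bbar μ κ θ₀ / (1 - M.γ) ^ 3) := by ring
      have h9 : (T : ℝ) * (1 / (2 * M.sigma H κ) * e ^ 2) = T * e ^ 2 / (2 * M.sigma H κ) := by
        ring
      rw [h9, lt_div_iff₀ (by positivity)]
      linarith)
  refine ⟨t, ht, ?_⟩
  have hgt' : ‖M.gradL μ κ (M.iter μ κ θ₀ t)‖ ≤ e :=
    abs_le_of_sq_le_sq' hgt (by positivity) |>.2
  have hmain := M.J_sub_J_le (M.iterPolicy μ κ θ₀ t) πs hμ.1 hρ.1 hρμ hdμ hκ0.le h1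
    (M.piLB₁_le μ κ θ₀ (Finset.mem_Icc.1 ht).1) (fun y x => by
      rw [RiskMDP.iterPolicy, RiskMDP.augPolicy_softmaxPolicy]
      refine neg_le_visits_mul_advantage
        ((M.abs_barrierGradient_le_norm μ κ _ y x).trans (hgt'.trans ?_))
      have hw : 1 / (Fintype.card S * Fintype.card (EtaGrid H) : ℝ)
          ≤ RiskMDP.augWeight S H y := by
        rcases y with s | z
        · exact one_div_le_one_div_of_le hS (le_mul_of_one_le_right hS.le hSE)
        · simp only [RiskMDP.augWeight, Sum.elim_inr, unifDist, Fintype.card_prod, Nat.cast_mul,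
            le_refl]
      rw [he, ← div_div, Fintype.card_prod, Nat.cast_mul]
      refine div_le_div_of_nonneg_right ?_ (by positivity)
      rw [div_eq_mul_one_div]
      exact mul_le_mul_of_nonneg_left hw hκ0.le)
  have hJ : M.J πs ρ ≤ M.Jstar H ρ := by
    have : Nonempty (RiskPolicy S A H) := ⟨πs⟩
    exact le_ciInf hπs
  change _ ≤ κ * M.D₂ μ ρ πs κ θ₀ at hmain
  -- The choice of `κ` leaves half of the permitted error unspent.
  have hκD : κ * M.D₂ μ ρ πs κ θ₀ = ε / 2 := by
    set D := M.D₂ μ ρ πs κ θ₀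
    have hκ' : κ = ε / (2 * D) := hκ
    rw [hκ']
    field_simp
  linarith
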